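/- Let $K$ be a field of characteristic $0$ (for instance $K=\mathbb{R}$). An Appell sequence over $K$ is a sequence $(A_n)_{n\ge 0}$ in $K[x]$ with $A_0=1$ and $A_n'=nA_{n-1}$ for $n\ge 1$; it is central if $A_1(0)=0$. Put $f_A(t)=\sum_{k\ge 0}A_k(0)\,t^k/k!$, a formal power series with constant term $1$. For a partition $\lambda=(\lambda_1\ge\cdots\ge\lambda_r>0)$ let $(n_1,\dots,n_r)=(\lambda_r,\lambda_{r-1}+1,\dots,\lambda_1+r-1)$ and $$A_\lambda=\frac{\det\bigl[A_{n_i}^{(j-1)}\bigr]_{1\le i,j\le r}}{\det\bigl[n_i^{\,j-1}\bigr]_{1\le i,j\le r}}\in K[x],$$ so that $A_\emptyset=1$, and let $F_\lambda$ be the number of standard Young tableaux of shape $\lambda$, i.e. of saturated chains from $\emptyset$ to $\lambda$ in Young's lattice. **Theorem.** Let $A$ be an Appell sequence over $K$ and let $c_1,c_2,\dots\in K$ be given by $\log f_A(t)=\sum_{k\ge 1}c_k\,t^k/k!$. Then there is exactly one Appell sequence $B=(B_n)_{n\ge0}$ over $K$ with $$\log f_B(t)=\sum_{k\ge 2}\frac{c_k^2}{(k-1)!}\,\frac{t^k}{k!},$$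 it is central, and for every $n\ge 0$ $$\sum_{\lambda\vdash n}\frac{F_\lambda^2}{n!}\,A_\lambda(x)^2=B_n\bigl((x+c_1)^2\bigr)$$ as polynomials in $x$. The left-hand side is the second moment of $A_\lambda$ when $\lambda\vdash n$ is weighted by the Plancherel measure $F_\lambda^2/n!$. -/

import Mathlib

open Polynomial
open scoped Nat

noncomputable section

namespace WronskianAppell

/-! ### Partitions and standard Young tableaux

A partition is represented by its Young diagram: the parts of `μ` are `μ.rowLen 0 ≥ μ.rowLen 1 ≥ …`,
its length is `μ.colLen 0`, and its size is `μ.card`. Young's lattice is the inclusion order. -/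

theorem finite_card_eq (n : ℕ) : {μ : YoungDiagram | μ.card = n}.Finite := by
  have hinj : Set.InjOn YoungDiagram.cells {μ : YoungDiagram | μ.card = n} := by
    intro μ _ ν _ h
    exact YoungDiagram.ext h
  refine Set.Finite.of_finite_image ?_ hinj
  refine (Finset.finite_toSet (Finset.range n ×ˢ Finset.range n).powerset).subset ?_
  rintro _ ⟨μ, hμ, rfl⟩
  have hμ' : μ.cells.card = n := hμ
  simp only [Finset.mem_coe, Finset.mem_powerset]
  rintro ⟨i, j⟩ hij
  have hij' : (i, j) ∈ μ := hij
  have h1 := YoungDiagram.mem_iff_lt_colLen.1 hij'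
  have h2 := YoungDiagram.mem_iff_lt_rowLen.1 hij'
  rw [YoungDiagram.colLen_eq_card] at h1
  rw [YoungDiagram.rowLen_eq_card] at h2
  have h3 : (μ.col j).card ≤ μ.cells.card := Finset.card_le_card (Finset.filter_subset _ _)
  have h4 : (μ.row i).card ≤ μ.cells.card := Finset.card_le_card (Finset.filter_subset _ _)
  simp only [Finset.mem_product, Finset.mem_range]
  omega

/-- The finite set of all partitions of `n`. -/
def partitionsOf (n : ℕ) : Finset YoungDiagram := (finite_card_eq n).toFinset

/-- `ν` covers `μ` in Young's lattice: `μ` is contained in `ν` and `ν` has exactly one more cell. -/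
def Covers (ν μ : YoungDiagram) : Prop := μ ≤ ν ∧ ν.card = μ.card + 1

/-- The standard Young tableaux of shape `μ`: saturated chains
`∅ = ν 0 ⋖ ν 1 ⋖ ⋯ ⋖ ν |μ| = μ` in Young's lattice. -/
def standardTableaux (μ : YoungDiagram) : Set (Fin (μ.card + 1) → YoungDiagram) :=
  {ν | ν 0 = ⊥ ∧ ν (Fin.last μ.card) = μ ∧ ∀ i : Fin μ.card, Covers (ν i.succ) (ν i.castSucc)}

theorem finite_standardTableaux (μ : YoungDiagram) : (standardTableaux μ).Finite := by
  have hfin : (Set.Iic μ).Finite := by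
    have hinj : Set.InjOn YoungDiagram.cells (Set.Iic μ) := by
      intro a _ b _ h
      exact YoungDiagram.ext h
    refine Set.Finite.of_finite_image ?_ hinj
    refine (Finset.finite_toSet μ.cells.powerset).subset ?_
    rintro _ ⟨ν, hν, rfl⟩
    simpa using YoungDiagram.cells_subset_iff.2 hν
  refine (Set.Finite.pi' (fun _ : Fin (μ.card + 1) => hfin)).subset ?_
  rintro ν ⟨-, hlast, hcov⟩ i
  have hmono : Monotone ν := Fin.monotone_iff_le_succ.2 fun i => (hcov i).1
  have h := hmono (Fin.le_last i)
  rwa [hlast] at h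

/-- `F_μ`, the number of standard Young tableaux of shape `μ`. -/
def numTableaux (μ : YoungDiagram) : ℕ := (standardTableaux μ).ncard

/-- The degree vector `(λ_r, λ_{r-1} + 1, …, λ_1 + r - 1)` of a partition of length `r`
(indexed from zero). -/
def degreeVector (μ : YoungDiagram) (i : Fin (μ.colLen 0)) : ℕ :=
  μ.rowLen i.rev + i

/-! ### Appell sequences -/

variable {K : Type*} [Field K]

/-- `A` is an Appell sequence: `A_0 = 1` and `A_n' = n A_{n-1}` for all `n ≥ 1`. -/
structure IsAppell (A : ℕ → K[X]) : Prop where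
  zero : A 0 = 1
  deriv : ∀ n : ℕ, derivative (A (n + 1)) = C ((n + 1 : ℕ) : K) * A n

/-- A sequence `A` of polynomials is central if `A_1(0) = 0`. -/
def IsCentral (A : ℕ → K[X]) : Prop := (A 1).eval 0 = 0

/-- The formal power series `f_A(t) = ∑_{k ≥ 0} A_k(0) t^k / k!`. -/
def momentSeries (A : ℕ → K[X]) : PowerSeries K :=
  PowerSeries.mk fun k => (A k).eval 0 / (k ! : K)

/-- The Wronskian determinant `det (P_i^{(j)})`, with `0 ≤ i, j < r`. -/
def wronskianDet {r : ℕ} (P : Fin r → K[X]) : K[X] :=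
  (Matrix.of fun i j : Fin r => derivative^[(j : ℕ)] (P i)).det

/-- The Wronskian polynomial `A_μ = Wr[A_{n_1}, …, A_{n_r}] / Δ(n_1, …, n_r)`, where
`(n_1, …, n_r)` is the degree vector of `μ` and `Δ` is the Vandermonde determinant. -/
def wronskianAppell (A : ℕ → K[X]) (μ : YoungDiagram) : K[X] :=
  C ((Matrix.vandermonde fun i => (degreeVector μ i : K)).det)⁻¹ *
    wronskianDet fun i => A (degreeVector μ i)

end WronskianAppell

end

open WronskianAppell

/-!
Newton's identities and Schur functions explain the theorem. The series `∑ A_n(x) t^n / n!` is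
`f_A(t) e^{xt}`, so the polynomials `A_n / n!` are complete homogeneous symmetric functions `h_n` for
the power sums `p_1 = x + c_1` and `p_k = c_k / (k-1)!`, `k ≥ 2`. Since `A_n^{(j)} = n! h_{n-j}`, the
Wronskian of the `A_{n_i}` is a Jacobi–Trudi determinant, and since `F_μ / |μ|!` is the same
determinant for `h_n = 1 / n!`, which reduces to a Vandermonde determinant, `F_μ A_μ / |μ|!` is the
Schur function `s_μ` (`C_numTableaux_mul_wronskianAppell`). The second moment divided by `n!` is then
`∑ s_μ²` over the partitions of `n`, and by the diagonal Cauchy identity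
`∑ s_μ² t^|μ| = exp (∑ p_k² t^k / k)` this is the homogeneous symmetric function for the power sums
`p_k²`. These are the power sums of `B` evaluated at `(x + c_1)²`.

The Cauchy identity (`isNewton_sum_schur_sq`) is proved by a recursion on the degree, which says that
the left side satisfies Newton's identities for the `p_k²`. For determinants `D(α) = det (h_{α_i-j})`
with `N` rows two facts are needed. Euler's identity (`IsNewton.jtDet`) says that the degree of `D(α)`
times `D(α)` is the sum of `p_k D(α - k e_i)` over all `k` and `i`. Conversely, `p_k D(α)` is the sum
of the `D(α + k e_i)` over `i` (`coeff_mul_jtDet`); this holds when `1 / ∑ h_n t^n` is a polynomial of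
degree at most `N`, since then raising a row degree is multiplication of the row by a companion
matrix, and the traces of its powers are the power sums. As `s_μ` involves only `h_0, …, h_|μ|`, the
sequence `h` can be changed in higher degrees to achieve this (`exists_truncation`). Summing
`D(α)²` over all functions `α`, and not only the increasing ones, turns the exchange of lowering and
raising into a plain bijection (`normSum_recursion`).

Existence and uniqueness of `B` come from `f' = f (log f)'`: the logarithm determines the values
`B_n(0)` by Newton's identities, and these determine an Appell sequence.
-/

noncomputable section

namespace WronskianAppell

/-! ### Jacobi–Trudi determinants and Newton's identities -/

section JacobiTrudi

variable {R : Type*} [CommRing R]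

/-- Replacing one row of `A` at a time by the same row of `B` and adding up the determinants is the
derivative of `det` at `A` in the direction `B`. -/
theorem sum_det_updateRow {ι : Type*} [Fintype ι] [DecidableEq ι] (A B : Matrix ι ι R) :
    ∑ i, (A.updateRow i (B i)).det = (A.adjugate * B).trace := by
  rw [Matrix.trace_mul_comm]
  simp only [Matrix.trace, Matrix.diag_apply, Matrix.mul_apply]
  refine Finset.sum_congr rfl fun i _ => ?_
  rw [← Matrix.cramer_transpose_apply, Matrix.cramer_eq_adjugate_mulVec,
    ← Matrix.adjugate_transpose]
  simp [Matrix.mulVec, dotProduct, Matrix.transpose_apply, mul_comm]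

/-- The entry `h_{a-j}` of a Jacobi–Trudi matrix, with `h` extended by zero to negative indices. -/
def shiftEntry (h : ℕ → R) (a j : ℕ) : R := if j ≤ a then h (a - j) else 0

/-- The Jacobi–Trudi determinant `det (h_{α_i - j})`, `0 ≤ i, j < N`, for arbitrary row degrees
`α`. -/
def jtDet {N : ℕ} (h : ℕ → R) (α : Fin N → ℕ) : R :=
  (Matrix.of fun i j : Fin N => shiftEntry h (α i) j).det

/-- Newton's identities `(n + 1) h_{n+1} = ∑ p_{k+1} h_{n-k}`, `0 ≤ k ≤ n`, between power sums and
complete homogeneous symmetric functions. The index is shifted: `p k` is the power sum of degree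
`k + 1`. -/
def IsNewton (p h : ℕ → R) : Prop :=
  ∀ n : ℕ, ((n + 1 : ℕ) : R) * h (n + 1) = ∑ k ∈ Finset.range (n + 1), p k * h (n - k)

theorem IsNewton.map {R S : Type*} [CommRing R] [CommRing S] (f : R →+* S) {p h : ℕ → R}
    (hp : IsNewton p h) : IsNewton (fun k => f (p k)) fun k => f (h k) := by
  intro n
  have := congrArg f (hp n)
  simpa using this

theorem shiftEntry_of_lt (h : ℕ → R) {a j : ℕ} (haj : a < j) : shiftEntry h a j = 0 :=
  if_neg (by omega)

theorem shiftEntry_add (h : ℕ → R) (n j : ℕ) : shiftEntry h (j + n) j = h n := by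
  simp [shiftEntry]

theorem shiftEntry_succ_succ (h : ℕ → R) (a j : ℕ) :
    shiftEntry h (a + 1) (j + 1) = shiftEntry h a j := by
  simp [shiftEntry]

/-- Newton's identities for one entry. The range may run up to `a` for every column `j`, since the
additional terms vanish; so it serves a whole row at once. -/
theorem IsNewton.shiftEntry {p h : ℕ → R} (hp : IsNewton p h) (a j : ℕ) :
    ((a : R) - j) * shiftEntry h a j =
      ∑ k ∈ Finset.range a, p k * WronskianAppell.shiftEntry h (a - 1 - k) j := by
  rcases lt_or_ge a (j + 1) with haj | haj
  · rw [Finset.sum_eq_zero]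
    · rcases eq_or_lt_of_le (Nat.lt_succ_iff.1 haj) with rfl | hlt
      · simp
      · simp [shiftEntry_of_lt h hlt]
    · intro k hk
      rw [Finset.mem_range] at hk
      rw [shiftEntry_of_lt h (by omega), mul_zero]
  · obtain ⟨n, rfl⟩ := Nat.exists_eq_add_of_le haj
    have h1 : ((j + 1 + n : ℕ) : R) - j = ((n + 1 : ℕ) : R) := by push_cast; ring
    rw [h1, show j + 1 + n = j + (n + 1) by ring, shiftEntry_add, hp n]
    refine Finset.sum_subset_zero_on_sdiff ?_ ?_ ?_
    · intro k hk
      simp only [Finset.mem_range] at hk ⊢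
      omega
    · intro k hk
      simp only [Finset.mem_sdiff, Finset.mem_range] at hk
      rw [shiftEntry_of_lt h (by omega), mul_zero]
    · intro k hk
      simp only [Finset.mem_range] at hk
      rw [show j + (n + 1) - 1 - k = j + (n - k) by omega, shiftEntry_add]

theorem jtDet_update {N : ℕ} (h : ℕ → R) (α : Fin N → ℕ) (i : Fin N) (a : ℕ) :
    jtDet h (Function.update α i a) =
      ((Matrix.of fun i j : Fin N => shiftEntry h (α i) j).updateRow i
        fun j => shiftEntry h a j).det := by
  unfold jtDet
  congr 1
  ext i' j
  by_cases hi : i' = i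
  · subst hi; simp
  · simp [hi]

/-- Euler's identity: the degree of a Jacobi–Trudi determinant, times the determinant, is the sum
over `k` of the `k`-th power sum times the effect of lowering one row degree by `k`. It holds because
`(α_i - j) h_{α_i - j}` is an entry of `D A - A J` for the diagonal matrices `D` of the `α_i` and `J`
of the `j`. -/
theorem IsNewton.jtDet {p h : ℕ → R} (hp : IsNewton p h) {N : ℕ} (α : Fin N → ℕ) :
    ((∑ i, (α i : R)) - ∑ j : Fin N, (j : R)) * jtDet h α =
      ∑ i, ∑ k ∈ Finset.range (α i),
        p k * WronskianAppell.jtDet h (Function.update α i (α i - 1 - k)) := by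
  set A : Matrix (Fin N) (Fin N) R :=
    Matrix.of fun i j : Fin N => WronskianAppell.shiftEntry h (α i) j with hA
  have key := sum_det_updateRow A
    (Matrix.diagonal (fun i => (α i : R)) * A - A * Matrix.diagonal fun j : Fin N => (j : R))
  have htr : (A.adjugate * (Matrix.diagonal (fun i => (α i : R)) * A -
      A * Matrix.diagonal fun j : Fin N => (j : R))).trace =
      ((∑ i, (α i : R)) - ∑ j : Fin N, (j : R)) * A.det := by
    rw [mul_sub, Matrix.trace_sub, Matrix.trace_mul_comm, Matrix.mul_assoc, Matrix.mul_adjugate,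
      ← Matrix.mul_assoc, Matrix.adjugate_mul]
    simp [Matrix.trace, sub_mul, Finset.sum_mul, mul_comm]
  rw [htr] at key
  change _ * A.det = _
  rw [← key]
  refine Finset.sum_congr rfl fun i _ => ?_
  have hrow : (Matrix.diagonal (fun i => (α i : R)) * A -
      A * Matrix.diagonal fun j : Fin N => (j : R)) i =
      ∑ k ∈ Finset.range (α i), p k • fun j : Fin N =>
        WronskianAppell.shiftEntry h (α i - 1 - k) j := by
    ext j
    rw [Finset.sum_apply]
    simp only [Matrix.sub_apply, Matrix.diagonal_mul, Matrix.mul_diagonal, Pi.smul_apply,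
      smul_eq_mul]
    rw [← hp.shiftEntry, hA]
    simp only [Matrix.of_apply]
    ring
  rw [hrow, ← Matrix.cramer_transpose_apply, map_sum, Finset.sum_apply]
  refine Finset.sum_congr rfl fun k _ => ?_
  rw [map_smul, Pi.smul_apply, Matrix.cramer_transpose_apply, jtDet_update, smul_eq_mul]

theorem jtDet_comp_perm {N : ℕ} (h : ℕ → R) (α : Fin N → ℕ) (σ : Equiv.Perm (Fin N)) :
    jtDet h (α ∘ σ) = (Equiv.Perm.sign σ : ℤ) * jtDet h α := by
  unfold jtDet
  rw [← Matrix.det_permute]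
  rfl

theorem jtDet_eq_zero_of_not_injective {N : ℕ} (h : ℕ → R) {α : Fin N → ℕ}
    (hα : ¬ Function.Injective α) : jtDet h α = 0 := by
  simp only [Function.Injective, not_forall] at hα
  obtain ⟨i, j, hij, hne⟩ := hα
  exact Matrix.det_zero_of_row_eq hne (by ext k; simp [hij])

/-! ### Multiplication by power sums -/

/-- The companion matrix of the polynomial with coefficients `1, e 1, …, e N`: it maps the row
`(h_a, h_{a-1}, …, h_{a-N+1})` to `(h_{a+1}, h_a, …, h_{a-N+2})` when `(∑ h_k t^k) (∑ e_k t^k) = 1`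
and `e` vanishes beyond `N`. The `e k` carry the sign `(-1)^k` of the elementary symmetric
functions. -/
def companion (N : ℕ) (e : ℕ → R) : Matrix (Fin N) (Fin N) R :=
  Matrix.of fun i j => if (j : ℕ) = 0 then -e (i + 1) else if (i : ℕ) + 1 = j then 1 else 0

section

variable {h e : ℕ → R}

theorem convolution_range (hconv : PowerSeries.mk h * PowerSeries.mk e = 1) (n : ℕ) :
    ∑ d ∈ Finset.range (n + 1), e d * h (n - d) = if n = 0 then 1 else 0 := by
  have := congrArg (PowerSeries.coeff n) hconv
  rw [mul_comm, PowerSeries.coeff_mul, PowerSeries.coeff_one] at this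
  simp only [PowerSeries.coeff_mk] at this
  rw [← this, Finset.Nat.sum_antidiagonal_eq_sum_range_succ_mk]

theorem sum_shiftEntry_eq_zero {N : ℕ} (hconv : PowerSeries.mk h * PowerSeries.mk e = 1)
    (he : ∀ j, N < j → e j = 0) (n : ℕ) (hn : n ≠ 0) :
    ∑ d ∈ Finset.range (N + 1), e d * shiftEntry h n d = 0 := by
  have h1 := convolution_range hconv n
  rw [if_neg hn] at h1
  rw [← h1]
  have h2 : ∀ M, N ≤ M → n ≤ M → ∑ d ∈ Finset.range (N + 1), e d * shiftEntry h n d =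
      ∑ d ∈ Finset.range (M + 1), e d * shiftEntry h n d := by
    intro M hM _
    refine Finset.sum_subset (Finset.range_subset_range.2 (by omega)) fun d _ hd => ?_
    simp only [Finset.mem_range, not_lt] at hd
    rw [he d (by omega), zero_mul]
  have h3 : ∀ M, N ≤ M → n ≤ M → ∑ d ∈ Finset.range (n + 1), e d * h (n - d) =
      ∑ d ∈ Finset.range (M + 1), e d * shiftEntry h n d := by
    intro M _ hM
    refine Finset.sum_subset_zero_on_sdiff (Finset.range_subset_range.2 (by omega))
      (fun d hd => ?_) fun d hd => ?_
    · simp only [Finset.mem_sdiff, Finset.mem_range] at hd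
      rw [shiftEntry_of_lt h (by omega), mul_zero]
    · simp only [Finset.mem_range] at hd
      rw [shiftEntry, if_pos (by omega)]
  rw [h2 (max N n) (le_max_left _ _) (le_max_right _ _),
    h3 (max N n) (le_max_left _ _) (le_max_right _ _)]

theorem shiftEntry_vecMul_companion {N : ℕ} (hconv : PowerSeries.mk h * PowerSeries.mk e = 1)
    (h0 : e 0 = 1) (he : ∀ j, N < j → e j = 0) (a : ℕ) :
    Matrix.vecMul (fun j : Fin N => shiftEntry h a j) (companion N e) =
      fun j : Fin N => shiftEntry h (a + 1) j := by
  ext ⟨j, hj⟩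
  simp only [Matrix.vecMul, dotProduct, companion, Matrix.of_apply]
  rcases j with _ | j
  · have := sum_shiftEntry_eq_zero hconv he (a + 1) (by omega)
    rw [Finset.sum_range_succ', h0, one_mul] at this
    simp only [shiftEntry_succ_succ] at this
    rw [eq_neg_of_add_eq_zero_right this, ← Fin.sum_univ_eq_sum_range
      (fun d => e (d + 1) * shiftEntry h a d)]
    simp [mul_comm]
  · simp only [Nat.succ_ne_zero, if_false, shiftEntry_succ_succ, Nat.add_right_cancel_iff]
    rw [Finset.sum_eq_single ⟨j, by omega⟩]
    · simp
    · intro b _ hb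
      rw [if_neg (fun hbj => hb (Fin.ext hbj)), mul_zero]
    · simp

theorem shiftEntry_vecMul_companion_pow {N : ℕ} (hconv : PowerSeries.mk h * PowerSeries.mk e = 1)
    (h0 : e 0 = 1) (he : ∀ j, N < j → e j = 0) (a k : ℕ) :
    Matrix.vecMul (fun j : Fin N => shiftEntry h a j) (companion N e ^ k) =
      fun j : Fin N => shiftEntry h (a + k) j := by
  induction k with
  | zero => simp
  | succ k ih =>
    rw [pow_succ, ← Matrix.vecMul_vecMul, ih, shiftEntry_vecMul_companion hconv h0 he, add_assoc]

/-- The lower unitriangular Toeplitz matrices of two inverse power series are inverse. -/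
theorem toeplitz_mul_toeplitz {N : ℕ} (hconv : PowerSeries.mk h * PowerSeries.mk e = 1) :
    (Matrix.of fun i j : Fin N => shiftEntry e i j) *
      (Matrix.of fun i j : Fin N => shiftEntry h i j) = 1 := by
  ext ⟨i, hi⟩ ⟨l, hl⟩
  simp only [Matrix.mul_apply, Matrix.of_apply, Matrix.one_apply, Fin.mk.injEq]
  rw [Fin.sum_univ_eq_sum_range (fun j => shiftEntry e i j * shiftEntry h j l)]
  rcases lt_or_ge i l with hil | hil
  · rw [if_neg hil.ne, Finset.sum_eq_zero]
    intro j _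
    rcases lt_or_ge i j with hij | hij
    · rw [shiftEntry_of_lt e hij, zero_mul]
    · rw [shiftEntry_of_lt h (by omega : j < l), mul_zero]
  · obtain ⟨n, rfl⟩ := Nat.exists_eq_add_of_le hil
    have h1 := convolution_range hconv n
    have h2 : (if l + n = l then (1 : R) else 0) = if n = 0 then 1 else 0 := by simp
    rw [h2, ← h1]
    symm
    refine Finset.sum_bij_ne_zero (fun d _ _ => l + n - d) ?_ ?_ ?_ ?_
    · intro d hd _
      simp only [Finset.mem_range] at hd ⊢
      omega
    · intro d hd _ d' hd' _ hdd
      simp only [Finset.mem_range] at hd hd' hdd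
      omega
    · intro j hj hne
      have hj1 : j ≤ l + n := by
        by_contra hcon
        exact hne (by rw [shiftEntry_of_lt e (by omega), zero_mul])
      have hj2 : l ≤ j := by
        by_contra hcon
        exact hne (by rw [shiftEntry_of_lt h (by omega : j < l), mul_zero])
      refine ⟨l + n - j, by simp only [Finset.mem_range]; omega, ?_, by omega⟩
      have : n - (l + n - j) = j - l := by omega
      rw [this]
      simpa [shiftEntry, hj1, hj2] using hne
    · intro d hd _
      simp only [Finset.mem_range] at hd
      rw [shiftEntry, shiftEntry, if_pos (by omega), if_pos (by omega)]
      congr 2 <;> omega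

theorem sum_range_sum_range (g : ℕ → R) (N : ℕ) :
    ∑ i ∈ Finset.range N, ∑ d ∈ Finset.range (i + 1), g d =
      ∑ d ∈ Finset.range N, ((N : R) - d) * g d := by
  induction N with
  | zero => simp
  | succ N ih =>
    rw [Finset.sum_range_succ, ih, Finset.sum_range_succ, Finset.sum_range_succ, ← add_assoc,
      ← Finset.sum_add_distrib]
    push_cast
    congr 1
    · exact Finset.sum_congr rfl fun d _ => by ring
    · ring

/-- The trace of a power of the companion matrix is a power sum. The rows `(h_{i-j})`, `i < N`, are
a basis in which the trace can be read off. -/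
theorem trace_companion_pow {N : ℕ} (hconv : PowerSeries.mk h * PowerSeries.mk e = 1)
    (h0 : e 0 = 1) (he : ∀ j, N < j → e j = 0) (k : ℕ) :
    (companion N e ^ (k + 1)).trace =
      PowerSeries.coeff k (PowerSeries.derivative R (PowerSeries.mk h) * PowerSeries.mk e) := by
  set g : ℕ → R := fun d => e d * shiftEntry h (k + 1) d with hg
  have h1 : (companion N e ^ (k + 1)).trace =
      ∑ i ∈ Finset.range N, ∑ d ∈ Finset.range (i + 1), g d := by
    conv_lhs => rw [← Matrix.one_mul (companion N e ^ (k + 1)), ← toeplitz_mul_toeplitz hconv,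
      Matrix.mul_assoc]
    have h2 : (Matrix.of fun i j : Fin N => shiftEntry h i j) * companion N e ^ (k + 1) =
        Matrix.of fun i j : Fin N => shiftEntry h (i + (k + 1)) j := by
      ext i j
      have := congrFun (shiftEntry_vecMul_companion_pow hconv h0 he (i : ℕ) (k + 1)) j
      simpa [Matrix.mul_apply, Matrix.vecMul, dotProduct] using this
    rw [h2, Matrix.trace]
    simp only [Matrix.diag_apply, Matrix.mul_apply, Matrix.of_apply]
    rw [Fin.sum_univ_eq_sum_range (fun i => ∑ j : Fin N, shiftEntry e i j *
      shiftEntry h (j + (k + 1)) i)]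
    refine Finset.sum_congr rfl fun i hi => ?_
    rw [Finset.mem_range] at hi
    rw [Fin.sum_univ_eq_sum_range (fun j => shiftEntry e i j * shiftEntry h (j + (k + 1)) i),
      ← Finset.sum_range_reflect g (i + 1)]
    symm
    refine Finset.sum_subset_zero_on_sdiff (Finset.range_subset_range.2 (by omega))
      (fun d hd => ?_) fun d hd => ?_
    · simp only [Finset.mem_sdiff, Finset.mem_range] at hd
      rw [shiftEntry_of_lt e (by omega), zero_mul]
    · simp only [Finset.mem_range] at hd
      rw [hg]
      simp only [shiftEntry]
      rw [if_pos (by omega : d ≤ i), show i + 1 - 1 - d = i - d by omega]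
      congr 1
      by_cases hik : i - d ≤ k + 1
      · rw [if_pos hik, if_pos (by omega)]
        congr 1; omega
      · rw [if_neg hik, if_neg (by omega)]
  have h2 : PowerSeries.coeff k (PowerSeries.derivative R (PowerSeries.mk h) * PowerSeries.mk e) =
      ∑ d ∈ Finset.range (k + 2), ((k + 1 : R) - d) * (e d * h (k + 1 - d)) := by
    rw [mul_comm, PowerSeries.coeff_mul, Finset.Nat.sum_antidiagonal_eq_sum_range_succ_mk,
      Finset.sum_range_succ _ (k + 1)]
    have : ((k + 1 : R) - ((k + 1 : ℕ) : R)) = 0 := by push_cast; ring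
    rw [this, zero_mul, add_zero]
    refine Finset.sum_congr rfl fun d hd => ?_
    rw [Finset.mem_range] at hd
    simp only [PowerSeries.coeff_mk, PowerSeries.coeff_derivative]
    rw [Nat.cast_sub (by omega), show k - d + 1 = k + 1 - d by omega]
    ring
  -- The sums with weights `k + 1 - d` and `N - d` agree because `∑ e_d h_{k+1-d} = 0`.
  have h3 : ∑ d ∈ Finset.range (k + 2), ((k + 1 : R) - d) * (e d * h (k + 1 - d)) =
      ∑ d ∈ Finset.range (k + 2), ((N : R) - d) * g d := by
    have h4 := convolution_range hconv (k + 1)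
    rw [if_neg (by omega)] at h4
    rw [← sub_eq_zero, ← Finset.sum_sub_distrib]
    calc _ = ∑ d ∈ Finset.range (k + 2), ((k + 1 : R) - N) * (e d * h (k + 1 - d)) := by
          refine Finset.sum_congr rfl fun d hd => ?_
          rw [Finset.mem_range] at hd
          simp only [hg, shiftEntry]
          rw [if_pos (by omega)]
          ring
      _ = 0 := by rw [← Finset.mul_sum, h4, mul_zero]
  rw [h1, h2, h3, sum_range_sum_range]
  -- The term `d = N` has coefficient zero; beyond `N` the `e_d` vanish.
  have hz : ∀ d, N ≤ d ∨ k + 2 ≤ d → ((N : R) - d) * g d = 0 := by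
    intro d hd
    rcases hd with hd | hd
    · rcases hd.eq_or_lt with rfl | hlt
      · simp
      · simp [hg, he d hlt]
    · simp only [hg]
      rw [shiftEntry_of_lt h (by omega)]
      simp
  rcases le_total N (k + 2) with hN | hN
  · refine Finset.sum_subset (Finset.range_subset_range.2 hN) fun d _ hd => hz d (Or.inl (by simpa using hd))
  · refine (Finset.sum_subset (Finset.range_subset_range.2 hN) fun d _ hd =>
      hz d (Or.inr (by simpa using hd))).symm

/-- Multiplication by a power sum is the sum over all ways to raise one row degree. Here `e` is
the inverse of `h`, and its vanishing beyond the number `N` of rows is essential: then raising all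
row degrees is multiplication of the matrix by a power of the companion matrix, whose trace is the
power sum. -/
theorem coeff_mul_jtDet {N : ℕ} (hconv : PowerSeries.mk h * PowerSeries.mk e = 1)
    (h0 : e 0 = 1) (he : ∀ j, N < j → e j = 0) (k : ℕ) (α : Fin N → ℕ) :
    PowerSeries.coeff k (PowerSeries.derivative R (PowerSeries.mk h) * PowerSeries.mk e) *
      jtDet h α = ∑ i, jtDet h (Function.update α i (α i + (k + 1))) := by
  set A : Matrix (Fin N) (Fin N) R := Matrix.of fun i j : Fin N => shiftEntry h (α i) j with hA
  have key := sum_det_updateRow A (A * companion N e ^ (k + 1))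
  rw [← Matrix.mul_assoc, Matrix.adjugate_mul, Matrix.smul_mul, Matrix.one_mul, Matrix.trace_smul,
    trace_companion_pow hconv h0 he, smul_eq_mul, mul_comm] at key
  change _ * A.det = _
  rw [← key]
  refine Finset.sum_congr rfl fun i _ => ?_
  rw [jtDet_update, ← shiftEntry_vecMul_companion_pow hconv h0 he]
  rfl

theorem isNewton_of_conv (hconv : PowerSeries.mk h * PowerSeries.mk e = 1) :
    IsNewton (fun k => PowerSeries.coeff k
      (PowerSeries.derivative R (PowerSeries.mk h) * PowerSeries.mk e)) h := by
  intro n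
  have h1 : PowerSeries.derivative R (PowerSeries.mk h) =
      PowerSeries.derivative R (PowerSeries.mk h) * PowerSeries.mk e * PowerSeries.mk h := by
    rw [mul_assoc, mul_comm (PowerSeries.mk e), hconv, mul_one]
  have h2 := congrArg (PowerSeries.coeff n) h1
  rw [PowerSeries.coeff_mul, PowerSeries.coeff_derivative, PowerSeries.coeff_mk,
    Finset.Nat.sum_antidiagonal_eq_sum_range_succ_mk] at h2
  simp only [PowerSeries.coeff_mk] at h2
  rw [← h2]
  push_cast
  ring

end

end JacobiTrudi

/-! ### Beta numbers of partitions -/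

section BetaNumbers

/-- The beta numbers of `μ` for `N` rows: the increasing sequence `λ_{N-i} + i`, `0 ≤ i < N`, with
`λ` padded by zeros. For `N` the number of parts this is `degreeVector μ`. If `μ` has more than `N`
parts, the parts beyond the `N`-th are ignored. -/
def betaNumbers (N : ℕ) (μ : YoungDiagram) (i : Fin N) : ℕ := μ.rowLen i.rev + i

theorem strictMono_betaNumbers (N : ℕ) (μ : YoungDiagram) : StrictMono (betaNumbers N μ) := by
  intro i j hij
  have h1 : μ.rowLen i.rev ≤ μ.rowLen j.rev := μ.rowLen_anti _ _ (by
    have : (j.rev : Fin N) < i.rev := Fin.rev_lt_rev.2 hij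
    exact this.le)
  have h2 : (i : ℕ) < j := hij
  simp only [betaNumbers]
  omega

theorem rowLen_eq_zero_of_colLen_le {μ : YoungDiagram} {i : ℕ} (hi : μ.colLen 0 ≤ i) :
    μ.rowLen i = 0 := by
  by_contra hne
  have h1 : (i, 0) ∈ μ := YoungDiagram.mem_iff_lt_rowLen.2 (Nat.pos_of_ne_zero hne)
  have h2 := YoungDiagram.mem_iff_lt_colLen.1 h1
  omega

theorem card_eq_sum_rowLen {μ : YoungDiagram} {N : ℕ} (hN : μ.colLen 0 ≤ N) :
    μ.card = ∑ i ∈ Finset.range N, μ.rowLen i := by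
  have h1 : ∀ c ∈ μ.cells, c.1 ∈ Finset.range N := by
    rintro ⟨i, j⟩ hc
    have h2 : (i, 0) ∈ μ := μ.up_left_mem le_rfl (Nat.zero_le j) hc
    have h3 := YoungDiagram.mem_iff_lt_colLen.1 h2
    simp only [Finset.mem_range]
    omega
  rw [YoungDiagram.card, Finset.card_eq_sum_card_fiberwise h1]
  exact Finset.sum_congr rfl fun i _ => (μ.rowLen_eq_card).symm

theorem sum_betaNumbers {μ : YoungDiagram} {N : ℕ} (hN : μ.colLen 0 ≤ N) :
    ∑ i, betaNumbers N μ i = μ.card + ∑ j : Fin N, (j : ℕ) := by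
  simp only [betaNumbers]
  rw [Finset.sum_add_distrib, card_eq_sum_rowLen hN, ← Fin.sum_univ_eq_sum_range]
  congr 1
  exact Equiv.sum_comp Fin.revPerm (fun i : Fin N => μ.rowLen i)

theorem le_of_betaNumbers_le {μ ν : YoungDiagram} {N : ℕ} (hN : μ.colLen 0 ≤ N)
    (h : betaNumbers N μ ≤ betaNumbers N ν) : μ ≤ ν := by
  rintro ⟨i, j⟩ hij
  have hij' : (i, j) ∈ μ := hij
  have h1 := YoungDiagram.mem_iff_lt_rowLen.1 hij'
  have hi : i < N := by
    by_contra hcon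
    rw [rowLen_eq_zero_of_colLen_le (by omega)] at h1
    omega
  have h2 := h (Fin.rev ⟨i, hi⟩)
  simp only [betaNumbers, Fin.rev_rev] at h2
  exact YoungDiagram.mem_iff_lt_rowLen.2 (by omega)

theorem rowLen_le_of_le {μ ν : YoungDiagram} (h : μ ≤ ν) (i : ℕ) : μ.rowLen i ≤ ν.rowLen i := by
  by_contra hcon
  have h1 : (i, ν.rowLen i) ∈ μ := YoungDiagram.mem_iff_lt_rowLen.2 (by omega)
  have h2 : (i, ν.rowLen i) ∈ ν := h h1
  exact lt_irrefl _ (YoungDiagram.mem_iff_lt_rowLen.1 h2)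

theorem colLen_le_of_le {μ ν : YoungDiagram} (h : μ ≤ ν) (i : ℕ) : μ.colLen i ≤ ν.colLen i := by
  by_contra hcon
  have h1 : (ν.colLen i, i) ∈ μ := YoungDiagram.mem_iff_lt_colLen.2 (by omega)
  have h2 : (ν.colLen i, i) ∈ ν := h h1
  exact lt_irrefl _ (YoungDiagram.mem_iff_lt_colLen.1 h2)

theorem betaNumbers_le_of_le {μ ν : YoungDiagram} (h : μ ≤ ν) (N : ℕ) :
    betaNumbers N μ ≤ betaNumbers N ν := fun _ =>
  Nat.add_le_add_right (rowLen_le_of_le h _) _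

theorem betaNumbers_injective {μ ν : YoungDiagram} {N : ℕ} (hμ : μ.colLen 0 ≤ N)
    (hν : ν.colLen 0 ≤ N) (h : betaNumbers N μ = betaNumbers N ν) : μ = ν :=
  le_antisymm (le_of_betaNumbers_le hμ h.le) (le_of_betaNumbers_le hν h.ge)

theorem add_sub_le_of_strictMono {N : ℕ} {α : Fin N → ℕ} (hα : StrictMono α) {i j : Fin N}
    (hij : i ≤ j) : α i + (j - i : ℕ) ≤ α j := by
  obtain ⟨i, hi⟩ := i
  obtain ⟨j, hj⟩ := j
  simp only [Fin.mk_le_mk] at hij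
  obtain ⟨d, rfl⟩ := Nat.exists_eq_add_of_le hij
  induction d with
  | zero => simp
  | succ d ih =>
    have h1 := ih (by omega) (by omega)
    have h2 : α ⟨i + d, by omega⟩ < α ⟨i + (d + 1), hj⟩ := hα (by simp)
    simp only at h1 ⊢
    omega

theorem le_of_strictMono {N : ℕ} {α : Fin N → ℕ} (hα : StrictMono α) (i : Fin N) :
    (i : ℕ) ≤ α i := by
  have := add_sub_le_of_strictMono hα (i := ⟨0, i.pos⟩) (j := i) (Fin.mk_le_mk.2 (Nat.zero_le _))
  simp only at this
  omega

theorem exists_betaNumbers_eq {N : ℕ} {α : Fin N → ℕ} (hα : StrictMono α) :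
    ∃ μ : YoungDiagram, μ.colLen 0 ≤ N ∧ betaNumbers N μ = α := by
  classical
  set S : Finset (ℕ × ℕ) := (Finset.range N ×ˢ Finset.range (∑ i, α i)).filter
    fun c => ∃ hc : c.1 < N, c.2 + (Fin.rev ⟨c.1, hc⟩ : Fin N) < α (Fin.rev ⟨c.1, hc⟩) with hS
  have hmem : ∀ i j, (i, j) ∈ S ↔ ∃ hi : i < N, j + (Fin.rev ⟨i, hi⟩ : Fin N) <
      α (Fin.rev ⟨i, hi⟩) := by
    intro i j
    simp only [hS, Finset.mem_filter, Finset.mem_product, Finset.mem_range]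
    refine ⟨fun h => h.2, fun h => ⟨⟨h.1, ?_⟩, h⟩⟩
    obtain ⟨hi, hj⟩ := h
    have := Finset.single_le_sum (f := α) (fun i _ => Nat.zero_le _)
      (Finset.mem_univ (Fin.rev ⟨i, hi⟩))
    omega
  have hlow : IsLowerSet (S : Set (ℕ × ℕ)) := by
    rintro ⟨i, j⟩ ⟨i', j'⟩ hle h
    rw [Finset.mem_coe, hmem] at h ⊢
    obtain ⟨hi, hj⟩ := h
    obtain ⟨h1, h2⟩ := Prod.mk_le_mk.1 hle
    have hi' : i' < N := by omega
    refine ⟨hi', ?_⟩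
    have h3 : Fin.rev ⟨i, hi⟩ ≤ Fin.rev ⟨i', hi'⟩ := Fin.rev_le_rev.2 (Fin.mk_le_mk.2 h1)
    have h4 := add_sub_le_of_strictMono hα h3
    have h5 : ((Fin.rev ⟨i, hi⟩ : Fin N) : ℕ) ≤ (Fin.rev ⟨i', hi'⟩ : Fin N) := h3
    omega
  let μ : YoungDiagram := ⟨S, hlow⟩
  have hμ : ∀ i j, (i, j) ∈ μ ↔ ∃ hi : i < N, j + (Fin.rev ⟨i, hi⟩ : Fin N) <
      α (Fin.rev ⟨i, hi⟩) := hmem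
  refine ⟨μ, ?_, ?_⟩
  · by_contra hcon
    obtain ⟨hN, -⟩ := (hμ N 0).1 (YoungDiagram.mem_iff_lt_colLen.2 (by omega))
    omega
  · ext i
    have h1 : ∀ j, j < μ.rowLen i.rev ↔ j + (i : ℕ) < α i := by
      intro j
      rw [← YoungDiagram.mem_iff_lt_rowLen, hμ]
      have hrev : ∀ hi : (i.rev : ℕ) < N, Fin.rev ⟨(i.rev : ℕ), hi⟩ = i := fun _ => Fin.rev_rev i
      refine ⟨fun ⟨hi, hj⟩ => ?_, fun hj => ⟨i.rev.2, ?_⟩⟩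
      · rwa [hrev hi] at hj
      · rwa [hrev i.rev.2]
    have h2 := le_of_strictMono hα i
    have h3 := h1 (α i - i)
    have h4 := h1 (μ.rowLen i.rev)
    simp only [betaNumbers]
    omega

theorem colLen_le_card (μ : YoungDiagram) : μ.colLen 0 ≤ μ.card := by
  rw [YoungDiagram.colLen_eq_card]
  exact Finset.card_le_card (Finset.filter_subset _ _)

/-- A hook of `μ` fits into `μ`: each of the other rows has a cell. -/
theorem degreeVector_le_card (μ : YoungDiagram) (i : Fin (μ.colLen 0)) :
    degreeVector μ i ≤ μ.card := by
  have h1 : μ.card = ∑ j : Fin (μ.colLen 0), μ.rowLen j := by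
    rw [card_eq_sum_rowLen le_rfl, Fin.sum_univ_eq_sum_range]
  rw [h1, ← Finset.add_sum_erase _ _ (Finset.mem_univ i.rev)]
  refine Nat.add_le_add_left ?_ _
  have h2 : ∀ j ∈ Finset.univ.erase i.rev, 1 ≤ μ.rowLen (j : Fin (μ.colLen 0)) := by
    intro j _
    have h3 : ((j : ℕ), 0) ∈ μ := YoungDiagram.mem_iff_lt_colLen.2 j.2
    exact YoungDiagram.mem_iff_lt_rowLen.1 h3
  have h4 := Finset.card_nsmul_le_sum _ _ _ h2
  rw [Finset.card_erase_of_mem (Finset.mem_univ _), Finset.card_univ, Fintype.card_fin,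
    smul_eq_mul, mul_one] at h4
  have := i.2
  omega

theorem mem_partitionsOf {n : ℕ} {μ : YoungDiagram} : μ ∈ partitionsOf n ↔ μ.card = n := by
  simp [partitionsOf]

end BetaNumbers

/-! ### Schur functions -/

section Schur

variable {R : Type*} [CommRing R]

/-- The Schur function `s_μ`, specialized so that the complete homogeneous symmetric functions take
the values `h k`, by the Jacobi–Trudi formula. -/
def schur (h : ℕ → R) (μ : YoungDiagram) : R := jtDet h (degreeVector μ)

theorem jtDet_betaNumbers_succ {h : ℕ → R} (h0 : h 0 = 1) {μ : YoungDiagram} {N : ℕ}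
    (hN : μ.colLen 0 ≤ N) : jtDet h (betaNumbers (N + 1) μ) = jtDet h (betaNumbers N μ) := by
  have hzero : betaNumbers (N + 1) μ 0 = 0 := by
    simp [betaNumbers, rowLen_eq_zero_of_colLen_le hN]
  have hsucc : ∀ i : Fin N, betaNumbers (N + 1) μ i.succ = betaNumbers N μ i + 1 := by
    intro i
    simp [betaNumbers, Fin.rev_succ, add_assoc]
  unfold jtDet
  rw [Matrix.det_succ_row_zero, Finset.sum_eq_single 0]
  · simp only [Matrix.of_apply, hzero]
    simp only [Fin.val_zero, pow_zero, one_mul, shiftEntry, le_refl, if_true, Nat.sub_self, h0,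
      Fin.succAbove_zero]
    congr 1
    ext i j
    simp only [Matrix.submatrix_apply, Matrix.of_apply, hsucc, Fin.val_succ]
    exact shiftEntry_succ_succ h _ _
  · intro j _ hj
    simp only [Matrix.of_apply, hzero]
    rw [shiftEntry_of_lt h (Nat.pos_of_ne_zero fun hj0 => hj (Fin.ext hj0)), mul_zero, zero_mul]
  · simp

theorem jtDet_betaNumbers {h : ℕ → R} (h0 : h 0 = 1) {μ : YoungDiagram} {N : ℕ}
    (hN : μ.colLen 0 ≤ N) : jtDet h (betaNumbers N μ) = schur h μ := by
  induction N, hN using Nat.le_induction with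
  | base => rfl
  | succ N hN ih => rw [jtDet_betaNumbers_succ h0 hN, ih]

/-- A Schur function of degree `n` depends on the `h k` with `k ≤ n` only. -/
theorem schur_congr {h h' : ℕ → R} {μ : YoungDiagram} (hh : ∀ k ≤ μ.card, h k = h' k) :
    schur h μ = schur h' μ := by
  unfold schur jtDet
  congr 1
  ext i j
  simp only [Matrix.of_apply, shiftEntry]
  split_ifs
  · exact hh _ ((Nat.sub_le _ _).trans (degreeVector_le_card μ i))
  · rfl

/-- The sum of the squares of all `N`-rowed Jacobi–Trudi determinants with row degrees of total
`M`. The degrees run over all functions, not only the increasing ones; this makes raising and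
lowering a degree inverse to each other without any sign or order condition. -/
def normSum (N : ℕ) (h : ℕ → R) (M : ℕ) : R :=
  ∑ α ∈ Finset.piAntidiag (Finset.univ : Finset (Fin N)) M, jtDet h α ^ 2

theorem mem_piAntidiag_univ {N M : ℕ} {α : Fin N → ℕ} :
    α ∈ Finset.piAntidiag (Finset.univ : Finset (Fin N)) M ↔ ∑ i, α i = M := by
  simp

theorem sum_update_add {N : ℕ} (α : Fin N → ℕ) (i : Fin N) (a : ℕ) :
    (∑ j, Function.update α i a j) + α i = (∑ j, α j) + a := by
  rw [Finset.sum_update_of_mem (Finset.mem_univ i), ← Finset.add_sum_erase _ α (Finset.mem_univ i),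
    Finset.sdiff_singleton_eq_erase]
  ring

/-- Euler's identity turns one factor of each square into a sum of lowered determinants with
power sums as coefficients; moving the lowering to the other factor as raising, which is
multiplication by the same power sum, squares the power sums. -/
theorem normSum_recursion {N : ℕ} {h e : ℕ → R}
    (hconv : PowerSeries.mk h * PowerSeries.mk e = 1)
    (h0 : e 0 = 1) (he : ∀ j, N < j → e j = 0) (M : ℕ) :
    ((M : R) - ∑ j : Fin N, (j : R)) * normSum N h M =
      ∑ k ∈ Finset.range M, PowerSeries.coeff k
        (PowerSeries.derivative R (PowerSeries.mk h) * PowerSeries.mk e) ^ 2 *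
          normSum N h (M - 1 - k) := by
  set p : ℕ → R := fun k => PowerSeries.coeff k
    (PowerSeries.derivative R (PowerSeries.mk h) * PowerSeries.mk e) with hp
  have hnewton : IsNewton p h := isNewton_of_conv hconv
  have hleft : ((M : R) - ∑ j : Fin N, (j : R)) * normSum N h M =
      ∑ i : Fin N, ∑ α ∈ Finset.piAntidiag (Finset.univ : Finset (Fin N)) M,
        ∑ k ∈ Finset.range (α i),
          p k * jtDet h (Function.update α i (α i - 1 - k)) * jtDet h α := by
    rw [normSum, Finset.mul_sum, Finset.sum_comm]
    refine Finset.sum_congr rfl fun α hα => ?_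
    rw [mem_piAntidiag_univ] at hα
    rw [sq, ← mul_assoc, ← hα, Nat.cast_sum, hnewton.jtDet α, Finset.sum_mul]
    exact Finset.sum_congr rfl fun i _ => Finset.sum_mul _ _ _
  have hright : ∑ k ∈ Finset.range M, p k ^ 2 * normSum N h (M - 1 - k) =
      ∑ i : Fin N, ∑ k ∈ Finset.range M,
        ∑ β ∈ Finset.piAntidiag (Finset.univ : Finset (Fin N)) (M - 1 - k),
          p k * jtDet h β * jtDet h (Function.update β i (β i + (k + 1))) := by
    rw [Finset.sum_comm]
    refine Finset.sum_congr rfl fun k _ => ?_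
    rw [normSum, Finset.mul_sum, Finset.sum_comm]
    refine Finset.sum_congr rfl fun β _ => ?_
    rw [← Finset.mul_sum, ← coeff_mul_jtDet hconv h0 he k β]
    simp only [hp]
    ring
  rw [hleft]
  change _ = ∑ k ∈ Finset.range M, p k ^ 2 * normSum N h (M - 1 - k)
  rw [hright]
  refine Finset.sum_congr rfl fun i _ => ?_
  rw [Finset.sum_sigma', Finset.sum_sigma']
  refine Finset.sum_bij' (fun x _ => ⟨x.2, Function.update x.1 i (x.1 i - 1 - x.2)⟩)
    (fun y _ => ⟨Function.update y.2 i (y.2 i + (y.1 + 1)), y.1⟩) ?_ ?_ ?_ ?_ ?_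
  · rintro ⟨α, k⟩ hx
    simp only [Finset.mem_sigma, mem_piAntidiag_univ, Finset.mem_range] at hx ⊢
    have h1 := sum_update_add α i (α i - 1 - k)
    have h2 := Finset.single_le_sum (f := α) (fun i _ => Nat.zero_le _) (Finset.mem_univ i)
    omega
  · rintro ⟨k, β⟩ hx
    simp only [Finset.mem_sigma, mem_piAntidiag_univ, Finset.mem_range,
      Function.update_self] at hx ⊢
    have h1 := sum_update_add β i (β i + (k + 1))
    omega
  · rintro ⟨α, k⟩ hx
    simp only [Finset.mem_sigma, Finset.mem_range] at hx
    simp only [Function.update_self, Function.update_idem]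
    rw [show α i - 1 - k + (k + 1) = α i by omega, Function.update_eq_self]
  · rintro ⟨k, β⟩ hx
    simp only [Function.update_self, Function.update_idem]
    rw [show β i + (k + 1) - 1 - k = β i by omega, Function.update_eq_self]
  · rintro ⟨α, k⟩ hx
    simp only [Finset.mem_sigma, Finset.mem_range] at hx
    simp only [Function.update_self, Function.update_idem]
    rw [show α i - 1 - k + (k + 1) = α i by omega, Function.update_eq_self]

theorem strictMono_comp_sort {N : ℕ} {α : Fin N → ℕ} (hα : Function.Injective α) :
    StrictMono (α ∘ Tuple.sort α) :=
  (Tuple.monotone_sort α).strictMono_of_injective (hα.comp (Tuple.sort α).injective)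

theorem normSum_eq_zero {N : ℕ} (h : ℕ → R) {M : ℕ} (hM : M < ∑ j : Fin N, (j : ℕ)) :
    normSum N h M = 0 := by
  refine Finset.sum_eq_zero fun α hα => ?_
  rw [mem_piAntidiag_univ] at hα
  rw [jtDet_eq_zero_of_not_injective, zero_pow two_ne_zero]
  intro hinj
  have h1 : ∑ j : Fin N, (j : ℕ) ≤ ∑ j, (α ∘ Tuple.sort α) j :=
    Finset.sum_le_sum fun j _ => le_of_strictMono (strictMono_comp_sort hinj) j
  have h2 : ∑ j, (α ∘ Tuple.sort α) j = ∑ j, α j := Equiv.sum_comp (Tuple.sort α) α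
  omega

/-- Row degrees that are not distinct contribute zero, and distinct ones are the rearrangements of
the beta numbers of a unique partition. -/
theorem normSum_eq_sum_schur {N : ℕ} {h : ℕ → R} (h0 : h 0 = 1) {m : ℕ} (hm : m ≤ N) :
    normSum N h (m + ∑ j : Fin N, (j : ℕ)) = (N ! : R) * ∑ μ ∈ partitionsOf m, schur h μ ^ 2 := by
  classical
  have hlen : ∀ μ ∈ partitionsOf m, μ.colLen 0 ≤ N := by
    intro μ hμ
    rw [mem_partitionsOf] at hμ
    have := colLen_le_card μ
    omega
  have h1 : (N ! : R) * ∑ μ ∈ partitionsOf m, schur h μ ^ 2 =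
      ∑ x ∈ partitionsOf m ×ˢ (Finset.univ : Finset (Equiv.Perm (Fin N))), schur h x.1 ^ 2 := by
    rw [Finset.sum_product]
    simp [Finset.mul_sum, Fintype.card_perm]
  rw [h1, normSum]
  symm
  refine Finset.sum_bij_ne_zero (fun x _ _ => betaNumbers N x.1 ∘ x.2) ?_ ?_ ?_ ?_
  · rintro ⟨μ, σ⟩ hx _
    simp only [Finset.mem_product, Finset.mem_univ, and_true] at hx
    rw [mem_piAntidiag_univ]
    have h2 : ∑ j, (betaNumbers N μ ∘ σ) j = ∑ j, betaNumbers N μ j :=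
      Equiv.sum_comp σ (betaNumbers N μ)
    rw [h2, sum_betaNumbers (hlen μ hx), mem_partitionsOf.1 hx]
  · rintro ⟨μ, σ⟩ hx _ ⟨ν, τ⟩ hy _ heq
    simp only [Finset.mem_product, Finset.mem_univ, and_true] at hx hy heq
    have hrange : Set.range (betaNumbers N μ) = Set.range (betaNumbers N ν) := by
      rw [← σ.surjective.range_comp (betaNumbers N μ), heq, τ.surjective.range_comp]
    have hbeta : betaNumbers N μ = betaNumbers N ν :=
      (StrictMono.range_inj (strictMono_betaNumbers N μ) (strictMono_betaNumbers N ν)).1 hrange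
    have hμν : μ = ν := betaNumbers_injective (hlen μ hx) (hlen ν hy) hbeta
    subst hμν
    have hστ : σ = τ := Equiv.ext fun i =>
      (strictMono_betaNumbers N μ).injective (congrFun heq i)
    rw [hστ]
  · intro α hα hne
    rw [mem_piAntidiag_univ] at hα
    have hinj : Function.Injective α := by
      by_contra hcon
      exact hne (by rw [jtDet_eq_zero_of_not_injective h hcon, zero_pow two_ne_zero])
    obtain ⟨μ, hμ, hbeta⟩ := exists_betaNumbers_eq (strictMono_comp_sort hinj)
    have hcomp : betaNumbers N μ ∘ ⇑(Tuple.sort α)⁻¹ = α := by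
      rw [hbeta]
      ext i
      simp
    have hcard : μ ∈ partitionsOf m := by
      rw [mem_partitionsOf]
      have h2 := sum_betaNumbers hμ
      rw [hbeta] at h2
      have h3 : ∑ j, (α ∘ Tuple.sort α) j = ∑ j, α j := Equiv.sum_comp (Tuple.sort α) α
      omega
    refine ⟨(μ, (Tuple.sort α)⁻¹), by simp [hcard], ?_, hcomp⟩
    intro hzero
    apply hne
    rw [← hcomp, jtDet_comp_perm, jtDet_betaNumbers h0 hμ, mul_pow, hzero, mul_zero]
  · rintro ⟨μ, σ⟩ hx _
    simp only [Finset.mem_product, Finset.mem_univ, and_true] at hx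
    rw [jtDet_comp_perm, jtDet_betaNumbers h0 (hlen μ hx), mul_pow]
    have : (((Equiv.Perm.sign σ : ℤ) : R)) ^ 2 = 1 := by
      rcases Int.units_eq_one_or (Equiv.Perm.sign σ) with hs | hs <;> simp [hs]
    rw [this, one_mul]

end Schur

/-! ### The diagonal Cauchy identity -/

section Cauchy

variable {R : Type*} [CommRing R]

theorem coeff_mul_congr {f f' g g' : PowerSeries R} {N : ℕ}
    (hf : ∀ k ≤ N, PowerSeries.coeff k f = PowerSeries.coeff k f')
    (hg : ∀ k ≤ N, PowerSeries.coeff k g = PowerSeries.coeff k g') {k : ℕ} (hk : k ≤ N) :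
    PowerSeries.coeff k (f * g) = PowerSeries.coeff k (f' * g') := by
  rw [PowerSeries.coeff_mul, PowerSeries.coeff_mul]
  refine Finset.sum_congr rfl fun x hx => ?_
  rw [Finset.HasAntidiagonal.mem_antidiagonal] at hx
  rw [hf _ (by omega), hg _ (by omega)]

theorem exists_inverse {h : ℕ → R} (h0 : h 0 = 1) :
    ∃ e : ℕ → R, e 0 = 1 ∧ PowerSeries.mk h * PowerSeries.mk e = 1 := by
  have h1 := PowerSeries.mul_invOfUnit (PowerSeries.mk h) 1 (by simp [h0])
  refine ⟨fun k => PowerSeries.coeff k (PowerSeries.invOfUnit (PowerSeries.mk h) 1), ?_, ?_⟩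
  · simp
  · have h2 : PowerSeries.mk (fun k => PowerSeries.coeff k
      (PowerSeries.invOfUnit (PowerSeries.mk h) 1)) =
        PowerSeries.invOfUnit (PowerSeries.mk h) 1 := by ext; simp
    rw [h2, h1]

/-- The sequence `h` can be changed beyond degree `N` so that its inverse becomes a polynomial of
degree at most `N`. -/
theorem exists_truncation {h : ℕ → R} (h0 : h 0 = 1) (N : ℕ) :
    ∃ h' e' : ℕ → R, h' 0 = 1 ∧ e' 0 = 1 ∧ PowerSeries.mk h' * PowerSeries.mk e' = 1 ∧
      (∀ j, N < j → e' j = 0) ∧ ∀ k ≤ N, h k = h' k := by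
  obtain ⟨e, he0, hconv⟩ := exists_inverse h0
  set e' : ℕ → R := fun j => if j ≤ N then e j else 0 with he'
  have he'0 : e' 0 = 1 := by simp [he', he0]
  obtain ⟨h', hh'0, hconv'⟩ := exists_inverse he'0
  refine ⟨h', e', hh'0, he'0, by rw [mul_comm, hconv'], fun j hj => if_neg (by omega), ?_⟩
  have hee : ∀ k ≤ N, PowerSeries.coeff k (PowerSeries.mk e') =
      PowerSeries.coeff k (PowerSeries.mk e) := by
    intro k hk
    simp [he', hk]
  intro k hk
  have h1 : PowerSeries.mk h = PowerSeries.mk e' * (PowerSeries.mk h' * PowerSeries.mk h) := by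
    rw [← mul_assoc, hconv', one_mul]
  have h2 : PowerSeries.mk h' = PowerSeries.mk e * (PowerSeries.mk h' * PowerSeries.mk h) := by
    rw [mul_comm (PowerSeries.mk h'), ← mul_assoc, mul_comm (PowerSeries.mk e), hconv, one_mul]
  have h3 := coeff_mul_congr (g := PowerSeries.mk h' * PowerSeries.mk h) hee (fun _ _ => rfl) hk
  rw [← h1, ← h2] at h3
  simpa using h3

/-- The first `N` power sums depend on `h 0, …, h N` only. -/
theorem IsNewton.congr {p p' h h' : ℕ → R} (hp : IsNewton p h) (hp' : IsNewton p' h')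
    (h0 : h 0 = 1) {N : ℕ} (hh : ∀ k ≤ N, h k = h' k) : ∀ k < N, p k = p' k := by
  intro k
  induction k using Nat.strong_induction_on with
  | _ k ih =>
    intro hk
    have h1 := hp k
    have h2 := hp' k
    rw [hh (k + 1) (by omega), h2, Finset.sum_range_succ, Finset.sum_range_succ] at h1
    have h3 : ∑ j ∈ Finset.range k, p' j * h' (k - j) = ∑ j ∈ Finset.range k, p j * h (k - j) := by
      refine Finset.sum_congr rfl fun j hj => ?_
      rw [Finset.mem_range] at hj
      rw [ih j hj (by omega), hh _ (by omega)]
    rw [h3, Nat.sub_self, ← hh 0 (by omega), h0, mul_one, mul_one] at h1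
    exact (add_left_cancel h1).symm

theorem isNewton_unique [IsDomain R] [CharZero R] {p h h' : ℕ → R} (hh : IsNewton p h)
    (hh' : IsNewton p h') (h0 : h 0 = h' 0) : h = h' := by
  ext n
  induction n using Nat.strong_induction_on with
  | _ n ih =>
    rcases n with _ | n
    · exact h0
    · have hn : ((n + 1 : ℕ) : R) ≠ 0 := Nat.cast_ne_zero.2 (Nat.succ_ne_zero n)
      refine mul_left_cancel₀ hn ?_
      rw [hh n, hh' n]
      exact Finset.sum_congr rfl fun k _ => by rw [ih (n - k) (by omega)]

/-- The diagonal Cauchy identity `∑ s_μ² t^|μ| = exp (∑ p_k² t^k / k)`, in the form of Newton's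
identities. -/
theorem isNewton_sum_schur_sq [IsDomain R] [CharZero R] {p h : ℕ → R} (h0 : h 0 = 1)
    (hp : IsNewton p h) :
    IsNewton (fun k => p k ^ 2) fun n => ∑ μ ∈ partitionsOf n, schur h μ ^ 2 := by
  intro n
  -- With `N = n + 1` rows all partitions of size at most `n + 1` are covered.
  set N := n + 1 with hN
  obtain ⟨h', e', h'0, e'0, hconv, he', hh⟩ := exists_truncation h0 N
  set p' : ℕ → R := fun k => PowerSeries.coeff k
    (PowerSeries.derivative R (PowerSeries.mk h') * PowerSeries.mk e') with hp'
  have hpp := IsNewton.congr hp (isNewton_of_conv hconv) h0 hh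
  have hS : ∀ m ≤ N, ∑ μ ∈ partitionsOf m, schur h μ ^ 2 =
      ∑ μ ∈ partitionsOf m, schur h' μ ^ 2 := by
    intro m hm
    refine Finset.sum_congr rfl fun μ hμ => ?_
    rw [mem_partitionsOf] at hμ
    rw [schur_congr fun k hk => hh k (by omega)]
  have hfac : (N ! : R) ≠ 0 := Nat.cast_ne_zero.2 (Nat.factorial_ne_zero N)
  refine mul_left_cancel₀ hfac ?_
  set δ := ∑ j : Fin N, (j : ℕ) with hδ
  have key := normSum_recursion hconv e'0 he' (n + 1 + δ)
  have h1 : (((n + 1 + δ : ℕ) : R) - ∑ j : Fin N, ((j : ℕ) : R)) = ((n + 1 : ℕ) : R) := by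
    rw [hδ]; push_cast; ring
  rw [h1, normSum_eq_sum_schur h'0 le_rfl] at key
  -- Row degrees of total less than `0 + 1 + ⋯ + (N - 1)` cannot be distinct.
  have h2 : ∑ k ∈ Finset.range (n + 1 + δ), p' k ^ 2 * normSum N h' (n + 1 + δ - 1 - k) =
      ∑ k ∈ Finset.range (n + 1), p' k ^ 2 * normSum N h' (n + 1 + δ - 1 - k) := by
    symm
    refine Finset.sum_subset (Finset.range_subset_range.2 (by omega)) fun k hk hk' => ?_
    simp only [Finset.mem_range, not_lt] at hk hk'
    rw [normSum_eq_zero h' (by omega), mul_zero]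
  calc (N ! : R) * (((n + 1 : ℕ) : R) * ∑ μ ∈ partitionsOf (n + 1), schur h μ ^ 2)
      = ((n + 1 : ℕ) : R) * ((N ! : R) * ∑ μ ∈ partitionsOf (n + 1), schur h' μ ^ 2) := by
        rw [hS (n + 1) le_rfl]; ring
    _ = ∑ k ∈ Finset.range (n + 1), p' k ^ 2 * normSum N h' (n + 1 + δ - 1 - k) := by
        rw [key, ← h2]
    _ = _ := by
        rw [Finset.mul_sum]
        refine Finset.sum_congr rfl fun k hk => ?_
        rw [Finset.mem_range] at hk
        change _ = (N ! : R) * (p k ^ 2 * ∑ μ ∈ partitionsOf (n - k), schur h μ ^ 2)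
        rw [hpp k hk, show n + 1 + δ - 1 - k = (n - k) + δ by omega,
          normSum_eq_sum_schur h'0 (by omega), hS _ (by omega)]
        ring

end Cauchy

/-! ### Counting standard tableaux -/

section Tableaux

/-- The saturated chains of length `n` from `∅` to `μ` in Young's lattice. Keeping `n` apart from
`μ.card` avoids dependent types in the recursion on `n`. -/
def saturatedChains (n : ℕ) (μ : YoungDiagram) : Set (Fin (n + 1) → YoungDiagram) :=
  {ν | ν 0 = ⊥ ∧ ν (Fin.last n) = μ ∧ ∀ i : Fin n, Covers (ν i.succ) (ν i.castSucc)}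

theorem numTableaux_eq_ncard {n : ℕ} {μ : YoungDiagram} (hμ : μ.card = n) :
    numTableaux μ = (saturatedChains n μ).ncard := by
  subst hμ
  rfl

theorem finite_saturatedChains {n : ℕ} {μ : YoungDiagram} (hμ : μ.card = n) :
    (saturatedChains n μ).Finite := by
  subst hμ
  exact finite_standardTableaux μ

open Classical in
/-- The partitions of `n` that are covered by `μ` in Young's lattice. -/
def coveredBy (n : ℕ) (μ : YoungDiagram) : Finset YoungDiagram :=
  (partitionsOf n).filter fun ν => Covers μ ν

theorem mem_coveredBy {n : ℕ} {μ ν : YoungDiagram} (hμ : μ.card = n + 1) :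
    ν ∈ coveredBy n μ ↔ Covers μ ν := by
  simp only [coveredBy, Finset.mem_filter, mem_partitionsOf, and_iff_right_iff_imp]
  intro h
  have := h.2
  omega

theorem card_of_mem_coveredBy {n : ℕ} {μ ν : YoungDiagram} (hν : ν ∈ coveredBy n μ) :
    ν.card = n := by
  simp only [coveredBy, Finset.mem_filter, mem_partitionsOf] at hν
  exact hν.1

/-- Removing the top `μ` of a saturated chain leaves a chain up to a partition covered by `μ`. -/
def saturatedChainsEquiv {n : ℕ} {μ : YoungDiagram} (hμ : μ.card = n + 1) :
    saturatedChains (n + 1) μ ≃ Σ ν : coveredBy n μ, saturatedChains n (ν : YoungDiagram) where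
  toFun c := ⟨⟨c.1 (Fin.last n).castSucc, (mem_coveredBy hμ).2 (by
      have h := c.2.2.2 (Fin.last n)
      rwa [Fin.succ_last, c.2.2.1] at h)⟩,
    ⟨Fin.init c.1, c.2.1, rfl, fun i => c.2.2.2 i.castSucc⟩⟩
  invFun x := ⟨Fin.snoc x.2.1 μ, by
    obtain ⟨⟨ν, hν⟩, ⟨c, hc0, hcl, hc⟩⟩ := x
    refine ⟨?_, by simp, fun i => ?_⟩
    · change (Fin.snoc (α := fun _ => YoungDiagram) c μ) (Fin.castSucc 0) = ⊥
      rw [Fin.snoc_castSucc, hc0]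
    · refine Fin.lastCases ?_ (fun i => ?_) i
      · simp only [Fin.succ_last, Fin.snoc_last, Fin.snoc_castSucc]
        rw [hcl]
        exact (mem_coveredBy hμ).1 hν
      · rw [← Fin.castSucc_succ]
        simp only [Fin.snoc_castSucc]
        exact hc i⟩
  left_inv c := by
    apply Subtype.ext
    have h := c.2.2.1
    simp only
    conv_rhs => rw [← Fin.snoc_init_self c.1]
    rw [h]
  right_inv x := by
    obtain ⟨⟨ν, hν⟩, ⟨c, hc⟩⟩ := x
    obtain rfl : c (Fin.last n) = ν := hc.2.1
    refine Sigma.ext (Subtype.ext (by simp)) ((Subtype.heq_iff_coe_eq fun x => by simp).2 ?_)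
    simp

theorem numTableaux_eq_sum {n : ℕ} {μ : YoungDiagram} (hμ : μ.card = n + 1) :
    numTableaux μ = ∑ ν ∈ coveredBy n μ, numTableaux ν := by
  have hcard : ∀ ν : coveredBy n μ, (ν : YoungDiagram).card = n := fun ν =>
    card_of_mem_coveredBy ν.2
  have hfin : ∀ ν : coveredBy n μ, Finite (saturatedChains n (ν : YoungDiagram)) := fun ν =>
    finite_saturatedChains (hcard ν)
  rw [numTableaux_eq_ncard hμ, ← Nat.card_coe_set_eq, Nat.card_congr (saturatedChainsEquiv hμ),
    Nat.card_sigma, ← Finset.sum_coe_sort (coveredBy n μ)]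
  refine Finset.sum_congr rfl fun ν _ => ?_
  rw [Nat.card_coe_set_eq, numTableaux_eq_ncard (hcard ν)]

theorem eq_bot_of_card_eq_zero {μ : YoungDiagram} (hμ : μ.card = 0) : μ = ⊥ :=
  YoungDiagram.ext (by rw [YoungDiagram.cells_bot]; exact Finset.card_eq_zero.1 hμ)

theorem numTableaux_of_card_eq_zero {μ : YoungDiagram} (hμ : μ.card = 0) : numTableaux μ = 1 := by
  rw [numTableaux_eq_ncard hμ, Set.ncard_eq_one]
  refine ⟨fun _ => ⊥, ?_⟩
  ext c
  simp only [saturatedChains, Set.mem_ofPred_eq, Set.mem_singleton_iff]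
  constructor
  · rintro ⟨h0, -⟩
    ext1 i
    rw [Fin.fin_one_eq_zero i, h0]
  · rintro rfl
    exact ⟨rfl, (eq_bot_of_card_eq_zero hμ).symm, fun i => i.elim0⟩

end Tableaux

section Pieri

variable {R : Type*} [CommRing R]

/-- If lowering a beta number of `μ` by `1` does not produce two equal rows, it removes a cell
of `μ`. -/
theorem exists_covered_of_jtDet_ne_zero {h : ℕ → R} {n N : ℕ} {μ : YoungDiagram}
    (hμ : μ.card = n + 1) (hN : n + 1 ≤ N) {i : Fin N} (hi : 0 < betaNumbers N μ i)
    (hne : jtDet h (Function.update (betaNumbers N μ) i (betaNumbers N μ i - 1)) ≠ 0) :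
    ∃ ν ∈ coveredBy n μ,
      betaNumbers N ν = Function.update (betaNumbers N μ) i (betaNumbers N μ i - 1) := by
  have hlen : μ.colLen 0 ≤ N := (colLen_le_card μ).trans (by omega)
  set α := betaNumbers N μ with hα
  have hmono : StrictMono α := strictMono_betaNumbers N μ
  have hinj : Function.Injective (Function.update α i (α i - 1)) := by
    by_contra hcon
    exact hne (jtDet_eq_zero_of_not_injective h hcon)
  have hmono' : StrictMono (Function.update α i (α i - 1)) := by
    refine Monotone.strictMono_of_injective (fun a b hab => ?_) hinj
    rcases hab.eq_or_lt with rfl | hlt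
    · exact le_rfl
    · have h1 := hmono hlt
      by_cases ha : a = i
      · have hb : b ≠ i := fun hb => hlt.ne (ha.trans hb.symm)
        rw [ha, Function.update_self, Function.update_of_ne hb]
        rw [ha] at h1
        omega
      · rw [Function.update_of_ne ha]
        by_cases hb : b = i
        · rw [hb, Function.update_self]
          rw [hb] at h1
          omega
        · rw [Function.update_of_ne hb]
          exact h1.le
  obtain ⟨ν, hν, hβ⟩ := exists_betaNumbers_eq hmono'
  refine ⟨ν, (mem_coveredBy hμ).2 ⟨le_of_betaNumbers_le (N := N) hν ?_, ?_⟩, hβ⟩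
  · rw [hβ]
    intro j
    by_cases hj : j = i
    · rw [hj, Function.update_self]
      exact Nat.sub_le _ _
    · rw [Function.update_of_ne hj]
  · have h1 := sum_betaNumbers hν
    have h2 : ∑ i, α i = _ := sum_betaNumbers hlen
    have h3 := sum_update_add α i (α i - 1)
    rw [hβ] at h1
    omega

theorem exists_update_of_covers {μ ν : YoungDiagram} (hcov : Covers μ ν) {N : ℕ}
    (hN : μ.colLen 0 ≤ N) :
    ∃ i, 0 < betaNumbers N μ i ∧
      betaNumbers N ν = Function.update (betaNumbers N μ) i (betaNumbers N μ i - 1) := by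
  have hN' : ν.colLen 0 ≤ N := (colLen_le_of_le hcov.1 0).trans hN
  have hle := betaNumbers_le_of_le hcov.1 N
  have hμ := sum_betaNumbers hN
  have hν := sum_betaNumbers hN'
  have hcard := hcov.2
  obtain ⟨i, -, hi⟩ : ∃ i ∈ Finset.univ, betaNumbers N ν i < betaNumbers N μ i := by
    apply Finset.exists_lt_of_sum_lt
    omega
  have hupd : ∀ j ∈ Finset.univ, Function.update (betaNumbers N ν) i (betaNumbers N ν i + 1) j ≤
      betaNumbers N μ j := by
    intro j _
    by_cases hj : j = i
    · rw [hj, Function.update_self]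
      omega
    · rw [Function.update_of_ne hj]
      exact hle j
  have hsum := sum_update_add (betaNumbers N ν) i (betaNumbers N ν i + 1)
  have heq := (Finset.sum_eq_sum_iff_of_le hupd).1 (by omega)
  refine ⟨i, by omega, ?_⟩
  ext j
  have h1 := heq j (Finset.mem_univ j)
  by_cases hj : j = i
  · rw [hj, Function.update_self] at h1 ⊢
    omega
  · rw [Function.update_of_ne hj] at h1 ⊢
    exact h1

/-- Lowering one row degree of a partition by `1` gives either a determinant with two equal rows or
a partition covered by it. -/
theorem sum_jtDet_update_eq {h : ℕ → R} (h0 : h 0 = 1) {n N : ℕ} {μ : YoungDiagram}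
    (hμ : μ.card = n + 1) (hN : n + 1 ≤ N) :
    ∑ i : Fin N, (if 0 < betaNumbers N μ i then
      jtDet h (Function.update (betaNumbers N μ) i (betaNumbers N μ i - 1)) else 0) =
      ∑ ν ∈ coveredBy n μ, schur h ν := by
  have hlen : μ.colLen 0 ≤ N := (colLen_le_card μ).trans (by omega)
  have hex : ∀ i : Fin N, (if 0 < betaNumbers N μ i then
      jtDet h (Function.update (betaNumbers N μ) i (betaNumbers N μ i - 1)) else 0) ≠ 0 →
      0 < betaNumbers N μ i ∧ ∃ ν ∈ coveredBy n μ,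
        betaNumbers N ν = Function.update (betaNumbers N μ) i (betaNumbers N μ i - 1) := by
    intro i hne
    have hi : 0 < betaNumbers N μ i := by
      by_contra hcon
      exact hne (if_neg hcon)
    rw [if_pos hi] at hne
    exact ⟨hi, exists_covered_of_jtDet_ne_zero hμ hN hi hne⟩
  have hcovlen : ∀ ν ∈ coveredBy n μ, ν.colLen 0 ≤ N := fun ν hν =>
    (colLen_le_of_le ((mem_coveredBy hμ).1 hν).1 0).trans hlen
  choose hpos f hf hfβ using hex
  refine Finset.sum_bij_ne_zero (fun i _ hne => f i hne) (fun i _ hne => hf i hne) ?_ ?_ ?_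
  · intro i _ hi j _ hj hij
    by_contra hne
    have h1 : betaNumbers N (f i hi) i = betaNumbers N (f j hj) i := by rw [hij]
    rw [hfβ, hfβ, Function.update_self, Function.update_of_ne hne] at h1
    have := hpos i hi
    omega
  · intro ν hν hne
    obtain ⟨i, hi, hβ⟩ := exists_update_of_covers ((mem_coveredBy hμ).1 hν) hlen
    have hne' : (if 0 < betaNumbers N μ i then
        jtDet h (Function.update (betaNumbers N μ) i (betaNumbers N μ i - 1)) else 0) ≠ 0 := by
      rw [if_pos hi, ← hβ, jtDet_betaNumbers h0 (hcovlen ν hν)]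
      exact hne
    exact ⟨i, Finset.mem_univ i, hne', betaNumbers_injective (hcovlen _ (hf i hne'))
      (hcovlen ν hν) (by rw [hfβ, hβ])⟩
  · intro i _ hne
    rw [if_pos (hpos i hne), ← hfβ i hne, jtDet_betaNumbers h0 (hcovlen _ (hf i hne))]

end Pieri

/-! ### Wronskian Appell polynomials as Schur functions -/

section Plancherel

variable {K : Type*} [Field K]

/-- The divided sequence `A_n / n!`, which satisfies `(A_n / n!)' = A_{n-1} / (n-1)!`. It plays the
role of the complete homogeneous symmetric functions. -/
def dividedAppell (A : ℕ → K[X]) (n : ℕ) : K[X] := C (n ! : K)⁻¹ * A n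

theorem dividedAppell_zero {A : ℕ → K[X]} (hA : IsAppell A) : dividedAppell A 0 = 1 := by
  simp [dividedAppell, hA.zero]

theorem eval_zero_dividedAppell (A : ℕ → K[X]) (n : ℕ) :
    (dividedAppell A n).eval 0 = (A n).eval 0 / (n ! : K) := by
  rw [dividedAppell, eval_C_mul, div_eq_inv_mul]

variable [CharZero K]

theorem isNewton_inv_factorial :
    IsNewton (fun k => if k = 0 then (1 : K) else 0) fun k => (k ! : K)⁻¹ := by
  intro n
  rw [Finset.sum_range_succ']
  simp only [Nat.succ_ne_zero, if_false, zero_mul, Finset.sum_const_zero, if_true, one_mul,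
    zero_add, Nat.sub_zero]
  have h1 : ((n + 1 : ℕ) : K) ≠ 0 := Nat.cast_ne_zero.2 n.succ_ne_zero
  have h2 : (n ! : K) ≠ 0 := Nat.cast_ne_zero.2 n.factorial_ne_zero
  rw [Nat.factorial_succ, Nat.cast_mul]
  field_simp

/-- `F_μ / |μ|!` is the value of `s_μ` at the power sums `1, 0, 0, …`. -/
theorem numTableaux_eq_schur (μ : YoungDiagram) :
    (numTableaux μ : K) = (μ.card ! : K) * schur (fun k => (k ! : K)⁻¹) μ := by
  generalize hn : μ.card = n
  induction n generalizing μ with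
  | zero =>
    rw [numTableaux_of_card_eq_zero hn, ← jtDet_betaNumbers (N := 0) (by simp)
      (by have := colLen_le_card μ; omega)]
    simp [jtDet]
  | succ n ih =>
    have hlen : μ.colLen 0 ≤ n + 1 := hn ▸ colLen_le_card μ
    have h1 := (isNewton_inv_factorial (K := K)).jtDet (betaNumbers (n + 1) μ)
    rw [jtDet_betaNumbers (by simp) hlen, ← Nat.cast_sum, sum_betaNumbers hlen, hn] at h1
    have h2 : (((n + 1 + ∑ j : Fin (n + 1), (j : ℕ) : ℕ) : K) - ∑ j : Fin (n + 1), ((j : ℕ) : K)) =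
        ((n + 1 : ℕ) : K) := by push_cast; ring
    have h3 : ∀ i : Fin (n + 1), ∑ k ∈ Finset.range (betaNumbers (n + 1) μ i),
        (if k = 0 then (1 : K) else 0) * jtDet (fun k => (k ! : K)⁻¹)
          (Function.update (betaNumbers (n + 1) μ) i (betaNumbers (n + 1) μ i - 1 - k)) =
        if 0 < betaNumbers (n + 1) μ i then jtDet (fun k => (k ! : K)⁻¹)
          (Function.update (betaNumbers (n + 1) μ) i (betaNumbers (n + 1) μ i - 1)) else 0 := by
      intro i
      simp [ite_mul, Finset.sum_ite_eq', Finset.mem_range]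
    rw [h2, Finset.sum_congr rfl fun i _ => h3 i, sum_jtDet_update_eq (by simp) hn le_rfl] at h1
    rw [numTableaux_eq_sum hn, Nat.factorial_succ, Nat.cast_mul, mul_right_comm, h1, Nat.cast_sum,
      Finset.sum_mul]
    refine Finset.sum_congr rfl fun ν hν => ?_
    rw [ih ν (card_of_mem_coveredBy hν), mul_comm]

/-- The columns `1 / (α_i - j)!` are, up to the row factors `1 / α_i!`, the falling factorials of
`α_i`, so that the determinant is a Vandermonde determinant. -/
theorem jtDet_inv_factorial {N : ℕ} (α : Fin N → ℕ) :
    jtDet (fun k => (k ! : K)⁻¹) α =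
      (∏ i, ((α i)! : K)⁻¹) * (Matrix.vandermonde fun i => (α i : K)).det := by
  have h1 : ∀ a j : ℕ, shiftEntry (fun k => (k ! : K)⁻¹) a j =
      (a ! : K)⁻¹ * (descPochhammer K j).eval (a : K) := by
    intro a j
    rw [descPochhammer_eval_eq_descFactorial, shiftEntry]
    have h2 : (a ! : K) ≠ 0 := Nat.cast_ne_zero.2 a.factorial_ne_zero
    split_ifs with hja
    · have h3 : ((a - j)! : K) ≠ 0 := Nat.cast_ne_zero.2 (a - j).factorial_ne_zero
      rw [← Nat.factorial_mul_descFactorial hja, Nat.cast_mul] at h2 ⊢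
      have h4 := right_ne_zero_of_mul h2
      field_simp
    · rw [Nat.descFactorial_eq_zero_iff_lt.2 (by omega)]
      simp
  unfold jtDet
  simp only [h1]
  rw [Matrix.det_eval_matrixOfPolynomials_eq_det_vandermonde (fun i => (α i : K))
      (fun j : Fin N => descPochhammer K j)
      (fun j => descPochhammer_natDegree K j) (fun j => monic_descPochhammer K j)]
  exact Matrix.det_mul_column (fun i => ((α i)! : K)⁻¹)
    (Matrix.of fun i j : Fin N => (descPochhammer K j).eval (α i : K))

theorem derivative_dividedAppell_succ {A : ℕ → K[X]} (hA : IsAppell A) (n : ℕ) :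
    derivative (dividedAppell A (n + 1)) = dividedAppell A n := by
  have h1 : ((n + 1 : ℕ) : K) ≠ 0 := Nat.cast_ne_zero.2 n.succ_ne_zero
  have h2 : (n ! : K) ≠ 0 := Nat.cast_ne_zero.2 n.factorial_ne_zero
  rw [dividedAppell, dividedAppell, derivative_C_mul, hA.deriv, ← mul_assoc, ← C_mul]
  congr 2
  rw [Nat.factorial_succ, Nat.cast_mul]
  field_simp

theorem iterate_derivative_of_isAppell {A : ℕ → K[X]} (hA : IsAppell A) (a j : ℕ) :
    derivative^[j] (A a) = C (a ! : K) * shiftEntry (dividedAppell A) a j := by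
  induction j with
  | zero =>
    have h1 : (a ! : K) ≠ 0 := Nat.cast_ne_zero.2 a.factorial_ne_zero
    simp only [Function.iterate_zero_apply, shiftEntry, Nat.zero_le, if_true, Nat.sub_zero]
    rw [dividedAppell, ← mul_assoc, ← C_mul, mul_inv_cancel₀ h1, C_1, one_mul]
  | succ j ih =>
    rw [Function.iterate_succ_apply', ih, derivative_C_mul]
    congr 1
    rcases lt_trichotomy a j with hlt | rfl | hgt
    · rw [shiftEntry_of_lt _ hlt, shiftEntry_of_lt _ (by omega), derivative_zero]
    · rw [shiftEntry_of_lt _ (Nat.lt_succ_self a)]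
      simp [shiftEntry, dividedAppell, hA.zero]
    · obtain ⟨n, rfl⟩ := Nat.exists_eq_add_of_lt hgt
      rw [show j + n + 1 = j + (n + 1) by ring, shiftEntry_add,
        show j + (n + 1) = (j + 1) + n by ring, shiftEntry_add,
        derivative_dividedAppell_succ hA]

theorem wronskianDet_of_isAppell {A : ℕ → K[X]} (hA : IsAppell A) (μ : YoungDiagram) :
    wronskianDet (fun i => A (degreeVector μ i)) =
      C (∏ i, ((degreeVector μ i)! : K)) * schur (dividedAppell A) μ := by
  unfold wronskianDet schur jtDet
  simp only [iterate_derivative_of_isAppell hA]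
  rw [map_prod]
  exact Matrix.det_mul_column (fun i => C ((degreeVector μ i)! : K))
    (Matrix.of fun i j : Fin (μ.colLen 0) =>
      shiftEntry (dividedAppell A) (degreeVector μ i) j)

/-- The normalization of `A_μ` by the Vandermonde determinant makes `F_μ A_μ / |μ|!` the Schur
function `s_μ` with `h_n = A_n / n!`. -/
theorem C_numTableaux_mul_wronskianAppell {A : ℕ → K[X]} (hA : IsAppell A) (μ : YoungDiagram) :
    C (numTableaux μ : K) * wronskianAppell A μ =
      C (μ.card ! : K) * schur (dividedAppell A) μ := by
  have hinj : Function.Injective fun i => (degreeVector μ i : K) :=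
    Nat.cast_injective.comp (strictMono_betaNumbers (μ.colLen 0) μ).injective
  have hdet := Matrix.det_vandermonde_ne_zero_iff.2 hinj
  have hprod : (∏ i, ((degreeVector μ i)! : K)) ≠ 0 :=
    Finset.prod_ne_zero_iff.2 fun i _ => Nat.cast_ne_zero.2 (Nat.factorial_ne_zero _)
  rw [numTableaux_eq_schur, wronskianAppell, wronskianDet_of_isAppell hA,
    show schur (fun k => (k ! : K)⁻¹) μ = _ from jtDet_inv_factorial (degreeVector μ),
    Finset.prod_inv_distrib, ← mul_assoc, ← mul_assoc, ← C_mul, ← C_mul]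
  congr 2
  field_simp

end Plancherel

/-! ### Logarithms of power series -/

section Logarithm

variable {K : Type*} [Field K] [CharZero K]

theorem derivative_eq_mul_derivative_logOf {f : PowerSeries K}
    (hf : PowerSeries.constantCoeff f = 1) :
    PowerSeries.derivative K f = f * PowerSeries.derivative K (PowerSeries.logOf f) := by
  have hs : PowerSeries.HasSubst (f - 1) :=
    PowerSeries.HasSubst.of_constantCoeff_zero' (by rw [map_sub, hf, map_one, sub_self])
  have hlog : (1 + PowerSeries.X) * PowerSeries.derivative K (PowerSeries.log K) = 1 := by
    rw [PowerSeries.deriv_log]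
    ext n
    rw [add_mul, one_mul, map_add]
    rcases n with _ | n
    · simp
    · rw [PowerSeries.coeff_succ_X_mul, PowerSeries.coeff_one, if_neg n.succ_ne_zero]
      simp [pow_succ]
  have hsub := congrArg (PowerSeries.substAlgHom hs) hlog
  rw [map_mul, map_add, map_one, PowerSeries.coe_substAlgHom, PowerSeries.subst_X hs,
    add_sub_cancel] at hsub
  rw [PowerSeries.logOf_eq, PowerSeries.derivative_subst hs, map_sub,
    PowerSeries.derivative_one, sub_zero, ← mul_assoc, hsub, one_mul]

/-- Newton's identities are the equation `h' = h l'` in coefficients. -/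
theorem logOf_eq_iff_isNewton {h l : ℕ → K} (h0 : h 0 = 1) (l0 : l 0 = 0) :
    PowerSeries.logOf (PowerSeries.mk h) = PowerSeries.mk l ↔
      IsNewton (fun k => ((k + 1 : ℕ) : K) * l (k + 1)) h := by
  have hf : PowerSeries.constantCoeff (PowerSeries.mk h) = 1 := by simp [h0]
  have hne : PowerSeries.mk h ≠ 0 := fun h1 => by simp [h1] at hf
  have h1 : IsNewton (fun k => ((k + 1 : ℕ) : K) * l (k + 1)) h ↔
      PowerSeries.derivative K (PowerSeries.mk h) =
        PowerSeries.mk h * PowerSeries.derivative K (PowerSeries.mk l) := by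
    rw [PowerSeries.ext_iff]
    refine forall_congr' fun n => ?_
    rw [mul_comm (PowerSeries.mk h), PowerSeries.coeff_mul,
      Finset.Nat.sum_antidiagonal_eq_sum_range_succ_mk]
    simp only [PowerSeries.coeff_derivative, PowerSeries.coeff_mk]
    push_cast
    simp only [mul_comm]
  rw [h1, derivative_eq_mul_derivative_logOf hf, mul_right_inj' hne]
  refine ⟨fun h2 => by rw [h2], fun h2 => PowerSeries.derivative.ext h2 ?_⟩
  rw [PowerSeries.constantCoeff_logOf hf]
  simp [l0]

/-- The sequence with initial term `1` that Newton's identities determine from the power sums. -/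
def newtonSolution (p : ℕ → K) : ℕ → K
  | 0 => 1
  | n + 1 => ((n + 1 : ℕ) : K)⁻¹ * ∑ k : Fin (n + 1), p k * newtonSolution p (n - k)

theorem isNewton_newtonSolution (p : ℕ → K) : IsNewton p (newtonSolution p) := by
  intro n
  have h1 : ((n + 1 : ℕ) : K) ≠ 0 := Nat.cast_ne_zero.2 n.succ_ne_zero
  rw [newtonSolution, mul_inv_cancel_left₀ h1,
    Fin.sum_univ_eq_sum_range fun k => p k * newtonSolution p (n - k)]

end Logarithm

/-! ### Appell sequences -/

section Appell

variable {K : Type*} [Field K] [CharZero K]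

theorem eq_of_derivative_eq {P Q : K[X]} (hd : derivative P = derivative Q)
    (h0 : P.eval 0 = Q.eval 0) : P = Q := by
  have h1 : derivative (P - Q) = 0 := by rw [derivative_sub, hd, sub_self]
  have h2 := eq_C_of_derivative_eq_zero h1
  rw [← sub_eq_zero, h2, coeff_zero_eq_eval_zero, eval_sub, h0, sub_self, C_0]

/-- The power sums belonging to `h_n = A_n / n!` are those belonging to the `A_n(0) / n!`, with
`X` added to the first one. Both sides of each identity have the same derivative and the same value
at `0`. -/
theorem isNewton_dividedAppell {A : ℕ → K[X]} (hA : IsAppell A) {π : ℕ → K}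
    (hπ : IsNewton π fun n => (A n).eval 0 / (n ! : K)) :
    IsNewton (fun k => C (π k) + if k = 0 then X else 0) (dividedAppell A) := by
  have hsum : ∀ n, ∑ k ∈ Finset.range (n + 1), (C (π k) + if k = 0 then X else 0) *
      dividedAppell A (n - k) =
      ∑ k ∈ Finset.range (n + 1), C (π k) * dividedAppell A (n - k) + X * dividedAppell A n := by
    intro n
    simp [add_mul, Finset.sum_add_distrib, ite_mul, Finset.sum_ite_eq']
  intro n
  rw [hsum]
  induction n with
  | zero =>
    refine eq_of_derivative_eq ?_ ?_
    · simp [derivative_dividedAppell_succ hA, dividedAppell_zero hA]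
    · have := hπ 0
      simp only [← eval_zero_dividedAppell] at this
      simpa [eval_finsetSum] using this
  | succ n ih =>
    refine eq_of_derivative_eq ?_ ?_
    · have h1 : derivative (∑ k ∈ Finset.range (n + 1 + 1), C (π k) * dividedAppell A (n + 1 - k)) =
          ∑ k ∈ Finset.range (n + 1), C (π k) * dividedAppell A (n - k) := by
        rw [derivative_sum, Finset.sum_range_succ]
        have h2 : derivative (C (π (n + 1)) * dividedAppell A (n + 1 - (n + 1))) = 0 := by
          rw [Nat.sub_self, dividedAppell_zero hA, mul_one, derivative_C]
        rw [h2, add_zero]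
        refine Finset.sum_congr rfl fun k hk => ?_
        rw [Finset.mem_range] at hk
        rw [derivative_C_mul, show n + 1 - k = (n - k) + 1 by omega,
          derivative_dividedAppell_succ hA]
      rw [derivative_add, h1, derivative_mul, derivative_natCast, zero_mul, zero_add,
        derivative_mul, derivative_X, one_mul, derivative_dividedAppell_succ hA,
        derivative_dividedAppell_succ hA]
      push_cast at ih ⊢
      linear_combination ih
    · have := hπ (n + 1)
      simp only [← eval_zero_dividedAppell] at this
      simpa [eval_finsetSum] using this

theorem isAppell_ext {A B : ℕ → K[X]} (hA : IsAppell A) (hB : IsAppell B)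
    (h : ∀ n, (A n).eval 0 = (B n).eval 0) : A = B := by
  ext1 n
  induction n with
  | zero => rw [hA.zero, hB.zero]
  | succ n ih => exact eq_of_derivative_eq (by rw [hA.deriv, hB.deriv, ih]) (h (n + 1))

theorem exists_isAppell {b : ℕ → K} (b0 : b 0 = 1) :
    ∃ B : ℕ → K[X], IsAppell B ∧ ∀ n, (B n).eval 0 / (n ! : K) = b n := by
  set q : ℕ → K[X] := fun n => ∑ k ∈ Finset.range (n + 1), C (b (n - k) / (k ! : K)) * X ^ k with hq
  have hfac : ∀ n : ℕ, (n ! : K) ≠ 0 := fun n => Nat.cast_ne_zero.2 n.factorial_ne_zero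
  have hderiv : ∀ n, derivative (q (n + 1)) = q n := by
    intro n
    simp only [hq]
    rw [Finset.sum_range_succ', derivative_add, derivative_sum]
    simp only [pow_zero, mul_one, derivative_C, add_zero]
    refine Finset.sum_congr rfl fun k _ => ?_
    rw [derivative_C_mul_X_pow, Nat.add_sub_cancel, Nat.add_sub_add_right]
    congr 2
    have h1 : ((k + 1 : ℕ) : K) ≠ 0 := Nat.cast_ne_zero.2 k.succ_ne_zero
    have h2 := hfac k
    rw [Nat.factorial_succ, Nat.cast_mul]
    field_simp
  refine ⟨fun n => C (n ! : K) * q n, ⟨by simp [hq, b0], fun n => ?_⟩, fun n => ?_⟩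
  · rw [derivative_C_mul, hderiv, Nat.factorial_succ, Nat.cast_mul, C_mul, mul_assoc]
  · have h1 : (q n).eval 0 = b n := by
      simp only [hq, eval_finsetSum]
      rw [Finset.sum_range_succ']
      simp
    rw [eval_C_mul, h1, mul_div_cancel_left₀ _ (hfac n)]

end Appell

/-! ### The second moment -/

section SecondMoment

variable {K : Type*} [Field K] [CharZero K]

theorem momentSeries_isNewton_iff {B : ℕ → K[X]} (hB : IsAppell B) {l : ℕ → K} (l0 : l 0 = 0) :
    PowerSeries.logOf (momentSeries B) = PowerSeries.mk l ↔
      IsNewton (fun k => ((k + 1 : ℕ) : K) * l (k + 1)) fun n => (B n).eval 0 / (n ! : K) :=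
  logOf_eq_iff_isNewton (by simp [hB.zero]) l0

theorem existsUnique_isAppell {l : ℕ → K} (l0 : l 0 = 0) :
    ∃! B : ℕ → K[X], IsAppell B ∧ PowerSeries.logOf (momentSeries B) = PowerSeries.mk l := by
  set b := newtonSolution fun k => ((k + 1 : ℕ) : K) * l (k + 1)
  have b0 : b 0 = 1 := newtonSolution.eq_1 _
  have hb : IsNewton _ b := isNewton_newtonSolution _
  obtain ⟨B, hB, hBb⟩ := exists_isAppell b0
  refine ⟨B, ⟨hB, ?_⟩, ?_⟩
  · rw [momentSeries_isNewton_iff hB l0]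
    simpa only [hBb] using hb
  · rintro B' ⟨hB', hlog⟩
    rw [momentSeries_isNewton_iff hB' l0] at hlog
    have h1 := isNewton_unique hlog hb (by simp [hB'.zero, b0])
    refine isAppell_ext hB' hB fun n => ?_
    have hfac : (n ! : K) ≠ 0 := Nat.cast_ne_zero.2 n.factorial_ne_zero
    have h2 : (B' n).eval 0 / (n ! : K) = (B n).eval 0 / (n ! : K) :=
      (congrFun h1 n).trans (hBb n).symm
    exact (div_left_inj' hfac).1 h2

theorem isCentral_of_logOf {B : ℕ → K[X]} (hB : IsAppell B) {l : ℕ → K} (l0 : l 0 = 0)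
    (l1 : l 1 = 0) (hlog : PowerSeries.logOf (momentSeries B) = PowerSeries.mk l) :
    IsCentral B := by
  rw [momentSeries_isNewton_iff hB l0] at hlog
  have := hlog 0
  simpa [IsCentral, l1, hB.zero] using this

/-- Both sides, divided by `n!`, satisfy Newton's identities with the squares of the power sums
of `A`. -/
theorem secondMoment_eq {A B : ℕ → K[X]} (hA : IsAppell A) (hB : IsAppell B) {a b : ℕ → K}
    (ha : IsNewton a fun n => (A n).eval 0 / (n ! : K))
    (hb : IsNewton b fun n => (B n).eval 0 / (n ! : K))
    (hb0 : b 0 = 0) (hab : ∀ k, k ≠ 0 → b k = a k ^ 2) (n : ℕ) :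
    ∑ μ ∈ partitionsOf n, C ((numTableaux μ : K) ^ 2 / (n ! : K)) * wronskianAppell A μ ^ 2 =
      (B n).comp ((X + C (a 0)) ^ 2) := by
  have hfac : (n ! : K) ≠ 0 := Nat.cast_ne_zero.2 n.factorial_ne_zero
  have hleft := isNewton_sum_schur_sq (dividedAppell_zero hA) (isNewton_dividedAppell hA ha)
  have hright := (isNewton_dividedAppell hB hb).map (compRingHom ((X + C (a 0)) ^ 2))
  have hp : (fun k => compRingHom ((X + C (a 0)) ^ 2) (C (b k) + if k = 0 then X else 0)) =
      fun k => (C (a k) + if k = 0 then X else 0) ^ 2 := by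
    ext1 k
    by_cases hk : k = 0
    · subst hk
      simp [hb0, add_comm]
    · simp [hk, hab k hk]
  rw [hp] at hright
  have h0 : ∑ μ ∈ partitionsOf 0, schur (dividedAppell A) μ ^ 2 =
      compRingHom ((X + C (a 0)) ^ 2) (dividedAppell B 0) := by
    have h1 : partitionsOf 0 = {⊥} := by
      ext μ
      rw [mem_partitionsOf, Finset.mem_singleton]
      exact ⟨eq_bot_of_card_eq_zero, fun h => by rw [h]; rfl⟩
    rw [h1, Finset.sum_singleton, ← jtDet_betaNumbers (N := 0) (dividedAppell_zero hA)
      (colLen_le_card ⊥), dividedAppell_zero hB]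
    simp [jtDet]
  have key : ∑ μ ∈ partitionsOf n, schur (dividedAppell A) μ ^ 2 =
      (dividedAppell B n).comp ((X + C (a 0)) ^ 2) :=
    congrFun (isNewton_unique hleft hright h0) n
  calc ∑ μ ∈ partitionsOf n, C ((numTableaux μ : K) ^ 2 / (n ! : K)) * wronskianAppell A μ ^ 2
      = C (n ! : K) * ∑ μ ∈ partitionsOf n, schur (dividedAppell A) μ ^ 2 := by
        rw [Finset.mul_sum]
        refine Finset.sum_congr rfl fun μ hμ => ?_
        have h1 := C_numTableaux_mul_wronskianAppell hA μ
        rw [mem_partitionsOf.1 hμ] at h1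
        have h2 : C ((numTableaux μ : K) ^ 2 / (n ! : K)) =
            C (n ! : K)⁻¹ * C (numTableaux μ : K) ^ 2 := by
          rw [← C_pow, ← C_mul, div_eq_inv_mul]
        have h3 : C (n ! : K)⁻¹ * C (n ! : K) = 1 := by
          rw [← C_mul, inv_mul_cancel₀ hfac, C_1]
        rw [h2, mul_assoc, ← mul_pow, h1, mul_pow, sq (C (n ! : K)), ← mul_assoc, ← mul_assoc, h3,
          one_mul]
    _ = (B n).comp ((X + C (a 0)) ^ 2) := by
        rw [key, dividedAppell, mul_comp, C_comp, ← mul_assoc, ← C_mul,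
          mul_inv_cancel₀ hfac, C_1, one_mul]

end SecondMoment
end WronskianAppell
end

open WronskianAppell
theorem theorem5p3 {K : Type*} [Field K] [CharZero K]
    (A : ℕ → K[X]) (hA : IsAppell A) (c : ℕ → K)
    (hc : PowerSeries.logOf (momentSeries A) =
      PowerSeries.mk fun k => if 1 ≤ k then c k / (k ! : K) else 0) :
    (∃! B : ℕ → K[X], IsAppell B ∧
      PowerSeries.logOf (momentSeries B) =
        PowerSeries.mk fun k => if 2 ≤ k then c k ^ 2 / ((k - 1)! : K) / (k ! : K) else 0) ∧
    ∀ B : ℕ → K[X], IsAppell B →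
      PowerSeries.logOf (momentSeries B) =
        (PowerSeries.mk fun k => if 2 ≤ k then c k ^ 2 / ((k - 1)! : K) / (k ! : K) else 0) →
      IsCentral B ∧
      ∀ n : ℕ,
        ∑ μ ∈ partitionsOf n,
            C ((numTableaux μ : K) ^ 2 / (n ! : K)) * wronskianAppell A μ ^ 2 =
          (B n).comp ((X + C (c 1)) ^ 2) := by
  refine ⟨existsUnique_isAppell (by simp), fun B hB hlog =>
    ⟨isCentral_of_logOf hB (by simp) (by simp) hlog, fun n => ?_⟩⟩
  rw [momentSeries_isNewton_iff hA (by simp)] at hc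
  rw [momentSeries_isNewton_iff hB (by simp)] at hlog
  have h := secondMoment_eq hA hB hc hlog (by simp) (fun k hk => ?_) n
  · simpa using h
  · have h1 : ((k + 1 : ℕ) : K) ≠ 0 := Nat.cast_ne_zero.2 k.succ_ne_zero
    have h2 : (k ! : K) ≠ 0 := Nat.cast_ne_zero.2 k.factorial_ne_zero
    rw [if_pos (by omega), if_pos (by omega), Nat.add_sub_cancel, Nat.factorial_succ, Nat.cast_mul]
    field_simp
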